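/- Let $k\ge 2$ be an integer and let $G$ be a finite simple graph on $n$ vertices. Say that $G$ has odd girth at least $g$ if it contains no odd cycle of length less than $g$. If $G$ has odd girth at least $2k+1$ and minimum degree $\delta(G)>\frac{3n}{4k}$, then $G$ contains an independent set of size at least $\frac{kn}{2k+1}$. -/

import Mathlib

/-- A graph `G` has odd girth at least `g` if it contains no cycle of odd length less than `g`. -/
def OddGirthAtLeast {V : Type*} (G : SimpleGraph V) (g : ℕ) : Prop :=
  ∀ (v : V) (c : G.Walk v v), c.IsCycle → Odd c.length → g ≤ c.length

/-! The independent set comes from a homomorphism to an odd cycle. If there is no odd closed walk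
the graph is bipartite. Otherwise let `2l+1` be the length of a shortest one. The girth hypothesis
gives `k ≤ l`, so the degree bound survives with `l` in place of `k`, and the conclusion for `l`
implies the one for `k`. Enlarge the graph to an edge-maximal `H` without odd closed walks shorter
than `2l+1`; then distinct non-adjacent vertices are joined by an even walk of length at most `2l-2`
(`OddFree.exists_maximal`). Fix a closed walk `C` of length `2l+1`. The heart is `exists_sits`:
every vertex is adjacent to both neighbours of some position of `C`. Adjacent vertices occupy
cyclically consecutive positions, and averaging over the rotations of a largest independent set of
the cycle finishes the proof.

The degree bound is used only through counting: for any `4l` positions on closed walks, some vertex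
is adjacent to at least four of them (`exists_four_le_card`). A vertex is adjacent to at most two
positions of one closed walk of length `2l+1`, and if to two, then it sits there. Hence two
overlapping walks yield a vertex sitting on both, by parity usually at the same position
(`OddFree.sits_pair`), and the walks can be rerouted through it.

This excludes a `K₄`-subdivision with three faces of length `2l+1` (`OddFree.not_tetra`): with the
total spoke length maximal, the vertex found by counting either lengthens a spoke or contradicts a
parity bound. A vertex with a single neighbour on `C` would produce such a subdivision or another
excluded configuration (`exists_adj_of_adj_zero`). -/

namespace SimpleGraph
variable {V : Type*} {G : SimpleGraph V}

/-! ### Walks of prescribed length and parity -/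

/-- There is a walk of length `n` from `u` to `v`. -/
def HasWalk (G : SimpleGraph V) (n : ℕ) (u v : V) : Prop :=
  ∃ p : G.Walk u v, p.length = n

theorem HasWalk.trans {m n : ℕ} {u v w : V} (h : G.HasWalk m u v) (h' : G.HasWalk n v w) :
    G.HasWalk (m + n) u w := by
  obtain ⟨p, rfl⟩ := h
  obtain ⟨q, rfl⟩ := h'
  exact ⟨p.append q, by simp⟩

theorem HasWalk.symm {n : ℕ} {u v : V} (h : G.HasWalk n u v) : G.HasWalk n v u := by
  obtain ⟨p, rfl⟩ := h
  exact ⟨p.reverse, by simp⟩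

theorem HasWalk.refl (u : V) : G.HasWalk 0 u u := ⟨Walk.nil, rfl⟩

theorem Adj.hasWalk {u v : V} (h : G.Adj u v) : G.HasWalk 1 u v := ⟨h.toWalk, by simp⟩

theorem HasWalk.congr {m n : ℕ} {u v : V} (h : G.HasWalk m u v) (e : m = n) :
    G.HasWalk n u v := e ▸ h

/-- Every closed walk of odd length has length at least `2 * k + 1`. -/
def OddFree (G : SimpleGraph V) (k : ℕ) : Prop :=
  ∀ (n : ℕ) (u : V), G.HasWalk n u u → n % 2 = 1 → 2 * k + 1 ≤ n

theorem OddFree.le_add {k m n : ℕ} {u v : V} (hG : G.OddFree k) (h : G.HasWalk m u v)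
    (h' : G.HasWalk n u v) : (m + n) % 2 = 1 → 2 * k + 1 ≤ m + n :=
  hG _ u (h.trans h'.symm)

theorem hasWalk_of_seq {F : ℕ → V} {i j : ℕ} (hij : i ≤ j)
    (h : ∀ t, i ≤ t → t < j → G.Adj (F t) (F (t + 1))) : G.HasWalk (j - i) (F i) (F j) := by
  induction j, hij using Nat.le_induction with
  | base => exact (HasWalk.refl _).congr (by omega)
  | succ j hij ih =>
    exact ((ih fun t h1 h2 => h t h1 (by omega)).trans (h j hij (by omega)).hasWalk).congr
      (by omega)

theorem HasWalk.exists_seq {n : ℕ} {u v : V} (h : G.HasWalk n u v) :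
    ∃ F : ℕ → V, F 0 = u ∧ F n = v ∧ ∀ i, i < n → G.Adj (F i) (F (i + 1)) := by
  obtain ⟨p, rfl⟩ := h
  exact ⟨p.getVert, by simp, by simp, fun i hi => p.adj_getVert_succ hi⟩

/-! ### Closed walks and vertices sitting on them -/

/-- The values `F 0, …, F L` form a closed walk of length `L`. -/
structure IsClosedSeq (G : SimpleGraph V) (L : ℕ) (F : ℕ → V) : Prop where
  closed : F L = F 0
  adj : ∀ i, i < L → G.Adj (F i) (F (i + 1))

theorem IsClosedSeq.hasWalk {L : ℕ} {F : ℕ → V} (hF : G.IsClosedSeq L F) {i j : ℕ}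
    (hij : i ≤ j) (hj : j ≤ L) : G.HasWalk (j - i) (F i) (F j) :=
  hasWalk_of_seq hij fun t _ h => hF.adj t (by omega)

theorem IsClosedSeq.reverse {L : ℕ} {F : ℕ → V} (hF : G.IsClosedSeq L F) :
    G.IsClosedSeq L fun i => F (L - i) where
  closed := by simp [hF.closed]
  adj i hi := by
    have := (hF.adj (L - (i + 1)) (by omega)).symm
    rwa [show L - (i + 1) + 1 = L - i by omega] at this

/-- The vertex `v` is adjacent to both neighbours of position `m` of the closed walk `F`. -/
structure Sits (G : SimpleGraph V) (L : ℕ) (F : ℕ → V) (v : V) (m : ℕ) : Prop where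
  lt : m < L
  next : G.Adj v (F (m + 1))
  prev : 0 < m → G.Adj v (F (m - 1))
  prev_zero : m = 0 → G.Adj v (F (L - 1))

theorem Sits.reverse {L : ℕ} {F : ℕ → V} {v : V} {m : ℕ}
    (h : G.Sits L F v m) (hm : 0 < m) : G.Sits L (fun i => F (L - i)) v (L - m) where
  lt := by have := h.lt; omega
  next := by
    have := h.prev hm
    have := h.lt
    rwa [show L - (L - m + 1) = m - 1 by omega]
  prev _ := by
    have := h.next
    have := h.lt
    rwa [show L - (L - m - 1) = m + 1 by omega]
  prev_zero h0 := by have := h.lt; omega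

theorem Sits.reverse_zero {L : ℕ} {F : ℕ → V} {v : V} (hL : 2 ≤ L)
    (h : G.Sits L F v 0) : G.Sits L (fun i => F (L - i)) v 0 where
  lt := h.lt
  next := h.prev_zero rfl
  prev h0 := by omega
  prev_zero _ := by
    have := h.next
    rwa [show L - (L - 1) = 0 + 1 by omega]

section
variable {L : ℕ} {F : ℕ → V} {v : V} {m i : ℕ}

theorem Sits.walk_self (hF : G.IsClosedSeq L F) (h : G.Sits L F v m) : G.HasWalk 2 v (F m) :=
  h.next.hasWalk.trans (hF.adj m h.lt).symm.hasWalk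

theorem Sits.walk_up (hF : G.IsClosedSeq L F) (h : G.Sits L F v m) (hi : m < i) (hiL : i ≤ L) :
    G.HasWalk (i - m) v (F i) :=
  (h.next.hasWalk.trans (hF.hasWalk (by omega : m + 1 ≤ i) hiL)).congr (by omega)

theorem Sits.walk_down (hF : G.IsClosedSeq L F) (h : G.Sits L F v m) (hi : i < m) :
    G.HasWalk (m - i) v (F i) :=
  ((h.prev (by omega)).hasWalk.trans
    (hF.hasWalk (by omega : i ≤ m - 1) (by have := h.lt; omega)).symm).congr (by omega)

theorem Sits.walk_up_around (hF : G.IsClosedSeq L F) (h : G.Sits L F v m) (hi : i < m) :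
    G.HasWalk (L - m + i) v (F i) := by
  have h1 := h.walk_up hF h.lt le_rfl
  rw [hF.closed] at h1
  exact (h1.trans (hF.hasWalk (Nat.zero_le i) (by have := h.lt; omega))).congr (by omega)

theorem Sits.walk_down_around (hF : G.IsClosedSeq L F) (h : G.Sits L F v m) (hi : m < i)
    (hiL : i < L) : G.HasWalk (L - i + m) v (F i) := by
  rcases Nat.eq_zero_or_pos m with rfl | hm
  · exact ((h.prev_zero rfl).hasWalk.trans (hF.hasWalk (by omega : i ≤ L - 1) (by omega)).symm).congr
      (by omega)
  · have h1 := h.walk_down hF hm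
    rw [← hF.closed] at h1
    exact (h1.trans (hF.hasWalk hiL.le le_rfl).symm).congr (by omega)

end

/-- If a vertex is adjacent to two positions of a closed walk of length `2 * k + 1`, then these
are the two neighbours of a single position. -/
theorem OddFree.adj_pair {k : ℕ} (hG : G.OddFree k) {F : ℕ → V}
    (hF : G.IsClosedSeq (2 * k + 1) F) {v : V} {i j : ℕ} (hij : i < j) (hj : j < 2 * k + 1)
    (hi' : G.Adj v (F i)) (hj' : G.Adj v (F j)) :
    j = i + 2 ∨ j = i + (2 * k - 1) := by
  -- The two ways round between the positions have opposite parity, so exactly one of them closes up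
  -- through `v` to an odd length.
  have h1 := hG.le_add ((hi'.hasWalk).trans (hF.hasWalk hij.le hj.le)) hj'.hasWalk
  have h2 := (hF.hasWalk (Nat.zero_le i) (by omega)).symm
  rw [← hF.closed] at h2
  have h3 := hG.le_add ((hi'.hasWalk).trans (h2.trans (hF.hasWalk hj.le le_rfl).symm)) hj'.hasWalk
  omega

/-- Any two neighbour positions are at cyclic distance two, and for `k ≥ 2` no three positions
modulo `2k+1` are pairwise at distance two. -/
theorem OddFree.sits_of_adj {k : ℕ} (hk : 2 ≤ k) (hG : G.OddFree k) {F : ℕ → V}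
    (hF : G.IsClosedSeq (2 * k + 1) F) {v : V} {i j : ℕ} (hij : i ≠ j) (hi : i < 2 * k + 1)
    (hj : j < 2 * k + 1) (hi' : G.Adj v (F i)) (hj' : G.Adj v (F j)) :
    ∃ m, G.Sits (2 * k + 1) F v m ∧
      ∀ t, t < 2 * k + 1 → G.Adj v (F t) →
        t = m + 1 ∨ t + 1 = m ∨ (m = 0 ∧ t = 2 * k) ∨ (m = 2 * k ∧ t = 0) := by
  wlog h : i < j generalizing i j
  · exact this hij.symm hj hi hj' hi' (by omega)
  have key : ∀ t, t < 2 * k + 1 → G.Adj v (F t) → t = i ∨ t = j := by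
    intro t ht ht'
    by_contra hne
    have a1 := hG.adj_pair hF h hj hi' hj'
    rcases lt_trichotomy t i with h1 | h1 | h1
    · have a2 := hG.adj_pair hF h1 hi ht' hi'
      have a3 := hG.adj_pair hF (h1.trans h) hj ht' hj'
      omega
    · omega
    · have a2 := hG.adj_pair hF h1 ht hi' ht'
      rcases lt_trichotomy t j with h2 | h2 | h2
      · have a3 := hG.adj_pair hF h2 hj ht' hj'
        omega
      · omega
      · have a3 := hG.adj_pair hF h2 ht hj' ht'
        omega
  have hcl := hF.closed
  rcases hG.adj_pair hF h hj hi' hj' with e | e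
  · refine ⟨i + 1, ⟨by omega, by rwa [show i + 1 + 1 = j by omega], fun _ => by simpa, by omega⟩, ?_⟩
    intro t ht ht'
    have := key t ht ht'
    omega
  · rcases Nat.eq_zero_or_pos i with rfl | hi0
    · refine ⟨2 * k, ⟨by omega, by rwa [hcl],
        fun _ => by rwa [show 2 * k - 1 = j by omega], by omega⟩, ?_⟩
      intro t ht ht'
      have := key t ht ht'
      omega
    · refine ⟨0, ⟨by omega, by rwa [show 0 + 1 = i by omega], by omega,
        fun _ => by rwa [show 2 * k + 1 - 1 = j by omega]⟩, ?_⟩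
      intro t ht ht'
      have := key t ht ht'
      omega

set_option maxHeartbeats 1000000 in
/-- A vertex which sits on two closed walks of length `2 * k + 1` that agree at `0` and `ℓ` sits
at the same position on both, with a few exceptions for extreme `ℓ`. -/
theorem OddFree.sits_pair {k : ℕ} (hk : 2 ≤ k) (hG : G.OddFree k) {X Y : ℕ → V}
    (hX : G.IsClosedSeq (2 * k + 1) X) (hY : G.IsClosedSeq (2 * k + 1) Y) {ℓ : ℕ} (hℓ : 1 ≤ ℓ)
    (hℓ' : ℓ < 2 * k) (h0 : X 0 = Y 0) (h1 : X ℓ = Y ℓ) {v : V} {m n : ℕ}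
    (hm : G.Sits (2 * k + 1) X v m) (hn : G.Sits (2 * k + 1) Y v n) :
    m = n ∨ (ℓ = 1 ∧ (m = 1 ∧ n = 2 * k ∨ m = 2 * k ∧ n = 1 ∨ m = 0 ∧ n = 2 ∨ m = 2 ∧ n = 0)) ∨
      ((ℓ = 2 ∨ ℓ = 2 * k - 1) ∧ (m = 0 ∧ n = ℓ ∨ m = ℓ ∧ n = 0)) := by
  have hmL := hm.lt
  have hnL := hn.lt
  have cond : ∀ {Z : ℕ → V} {p i : ℕ}, G.IsClosedSeq (2 * k + 1) Z → G.Sits (2 * k + 1) Z v p →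
      i < 2 * k + 1 → (p = i ∧ G.HasWalk 2 v (Z i)) ∨
        ∃ a, (p = i + a ∨ i = p + a) ∧ 1 ≤ a ∧ a ≤ 2 * k ∧ G.HasWalk a v (Z i) ∧
          G.HasWalk (2 * k + 1 - a) v (Z i) := by
    intro Z p i hZ hp hi
    have := hp.lt
    rcases lt_trichotomy p i with h | h | h
    · exact Or.inr ⟨i - p, by omega, by omega, by omega, hp.walk_up hZ h hi.le,
        (hp.walk_down_around hZ h hi).congr (by omega)⟩
    · subst h
      exact Or.inl ⟨rfl, hp.walk_self hZ⟩
    · exact Or.inr ⟨p - i, by omega, by omega, by omega, hp.walk_down hZ h,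
        (hp.walk_up_around hZ h).congr (by omega)⟩
  -- From a common vertex, `v` is reached along each walk with two complementary lengths. Comparing
  -- parities forces `m` and `n` to have equal cyclic distance from `i`, where sitting at `i` itself
  -- may also count as distance two.
  have key : ∀ i, i < 2 * k + 1 → X i = Y i →
      (m = i ∧ n = i) ∨
      (m = i ∧ ∃ b, (n = i + b ∨ i = n + b) ∧ (b = 2 ∨ b = 2 * k - 1)) ∨
      (n = i ∧ ∃ a, (m = i + a ∨ i = m + a) ∧ (a = 2 ∨ a = 2 * k - 1)) ∨
      (∃ a b, (m = i + a ∨ i = m + a) ∧ (n = i + b ∨ i = n + b) ∧ 1 ≤ a ∧ 1 ≤ b ∧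
        (a = b ∨ a + b = 2 * k + 1)) := by
    intro i hi hXY
    rcases cond hX hm hi with ⟨a, w⟩ | ⟨a, ha, ha1, ha2, w, w'⟩ <;>
    rcases cond hY hn hi with ⟨b, u⟩ | ⟨b, hb, hb1, hb2, u, u'⟩ <;> rw [← hXY] at u <;>
    try rw [← hXY] at u'
    · exact Or.inl ⟨a, b⟩
    · have := hG.le_add w u
      have := hG.le_add w u'
      exact Or.inr (Or.inl ⟨a, b, hb, by omega⟩)
    · have := hG.le_add w u
      have := hG.le_add w' u
      exact Or.inr (Or.inr (Or.inl ⟨b, a, ha, by omega⟩))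
    · have := hG.le_add w u
      have := hG.le_add w u'
      have := hG.le_add w' u
      have := hG.le_add w' u'
      exact Or.inr (Or.inr (Or.inr ⟨a, b, ha, hb, ha1, hb1, by clear ha hb; omega⟩))
  -- If `m ≠ n`, then apart from the cases with distance zero, `n` would be the mirror image of `m`
  -- about both `0` and `ℓ`, forcing `2ℓ ≡ 0` modulo `2k+1`.
  have k0 := key 0 (by omega) h0
  have kl := key ℓ (by omega) h1
  clear key cond
  rcases k0 with ⟨p1, p2⟩ | ⟨p1, b, hb, hb'⟩ | ⟨p1, a, ha, ha'⟩ | ⟨a, b, ha, hb, p1, p2, hab⟩ <;>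
  rcases kl with ⟨q1, q2⟩ | ⟨q1, b', hb1, hb1'⟩ | ⟨q1, a', ha1, ha1'⟩ | ⟨a', b', ha1, hb1, q1, q2, hab'⟩ <;>
  clear h0 h1 <;> rcases Nat.lt_trichotomy m n with hmn | hmn | hmn <;>
  try omega

/-! ### Double counting with the degree condition -/

theorem exists_four_le_card [Fintype V] [DecidableRel G.Adj] {k : ℕ}
    (hdeg : ∀ v, 3 * Fintype.card V < 4 * k * G.degree v) (s₁ s₂ s₃ s₄ : Finset ℕ)
    (f₁ f₂ f₃ f₄ : ℕ → V) (hk : 0 < k) (hs : 4 * k ≤ s₁.card + s₂.card + s₃.card + s₄.card) :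
    ∃ v, 4 ≤ (s₁.filter fun i => G.Adj v (f₁ i)).card + (s₂.filter fun i => G.Adj v (f₂ i)).card +
      (s₃.filter fun i => G.Adj v (f₃ i)).card + (s₄.filter fun i => G.Adj v (f₄ i)).card := by
  by_contra! hcon
  have count : ∀ (s : Finset ℕ) (f : ℕ → V),
      s.card * (3 * Fintype.card V + 1) ≤
        4 * k * ∑ v, (s.filter fun i => G.Adj v (f i)).card := by
    intro s f
    have : ∑ v, (s.filter fun i => G.Adj v (f i)).card = ∑ i ∈ s, G.degree (f i) := by
      simp_rw [Finset.card_filter]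
      rw [Finset.sum_comm]
      refine Finset.sum_congr rfl fun i _ => ?_
      rw [← Finset.card_filter, ← card_neighborFinset_eq_degree]
      congr 1
      ext v
      simp [adj_comm]
    rw [this, Finset.mul_sum, ← smul_eq_mul, ← Finset.sum_const]
    -- On natural numbers the strict bound `hdeg` is itself the inequality with `3 * card V + 1` on
    -- the left.
    exact Finset.sum_le_sum fun i _ => hdeg (f i)
  have h1 := count s₁ f₁
  have h2 := count s₂ f₂
  have h3 := count s₃ f₃
  have h4 := count s₄ f₄
  have h5 := Finset.sum_le_sum fun v (_ : v ∈ Finset.univ) => Nat.lt_succ_iff.mp (hcon v)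
  simp only [Finset.sum_add_distrib, Finset.sum_const, Finset.card_univ, smul_eq_mul] at h5
  have h6 := Nat.mul_le_mul_left (4 * k) h5
  have h7 := Nat.mul_le_mul_right (3 * Fintype.card V + 1) hs
  nlinarith

theorem OddFree.exists_sits_of_two_le_card [DecidableRel G.Adj] {k : ℕ} (hk : 2 ≤ k)
    (hG : G.OddFree k) {F : ℕ → V} (hF : G.IsClosedSeq (2 * k + 1) F) {v : V} {s : Finset ℕ}
    (hs : ∀ i ∈ s, i < 2 * k + 1) (h : 2 ≤ (s.filter fun i => G.Adj v (F i)).card) :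
    ∃ m, G.Sits (2 * k + 1) F v m ∧
      ∀ t, t < 2 * k + 1 → G.Adj v (F t) →
        t = m + 1 ∨ t + 1 = m ∨ (m = 0 ∧ t = 2 * k) ∨ (m = 2 * k ∧ t = 0) := by
  obtain ⟨i, hi, j, hj, hij⟩ := Finset.one_lt_card.mp h
  rw [Finset.mem_filter] at hi hj
  exact hG.sits_of_adj hk hF hij (hs i hi.1) (hs j hj.1) hi.2 hj.2

theorem card_filter_le_two {s : Finset ℕ} {p : ℕ → Prop} [DecidablePred p] (a b : ℕ)
    (h : ∀ i ∈ s, p i → i = a ∨ i = b) : (s.filter p).card ≤ 2 := by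
  refine (Finset.card_le_card (t := {a, b}) fun i hi => ?_).trans Finset.card_le_two
  rw [Finset.mem_filter] at hi
  simpa using h i hi.1 hi.2

theorem card_filter_le_one {s : Finset ℕ} {p : ℕ → Prop} [DecidablePred p] (a : ℕ)
    (h : ∀ i ∈ s, p i → i = a) : (s.filter p).card ≤ 1 := by
  refine (Finset.card_le_card (t := {a}) fun i hi => ?_).trans (by simp)
  rw [Finset.mem_filter] at hi
  simpa using h i hi.1 hi.2

theorem card_filter_eq_zero {s : Finset ℕ} {p : ℕ → Prop} [DecidablePred p]
    (h : ∀ i ∈ s, ¬ p i) : (s.filter p).card = 0 := by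
  simpa [Finset.filter_eq_empty_iff] using h

theorem OddFree.card_filter_le_two [DecidableRel G.Adj] {k : ℕ} (hk : 2 ≤ k)
    (hG : G.OddFree k) {F : ℕ → V} (hF : G.IsClosedSeq (2 * k + 1) F) (v : V) {s : Finset ℕ}
    (hs : ∀ i ∈ s, i < 2 * k + 1) : (s.filter fun i => G.Adj v (F i)).card ≤ 2 := by
  by_contra! h
  obtain ⟨m, hm, h'⟩ := hG.exists_sits_of_two_le_card hk hF hs h.le
  refine absurd h (not_lt.mpr ?_)
  have hlt := hm.lt
  refine SimpleGraph.card_filter_le_two (if m = 2 * k then 0 else m + 1)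
    (if m = 0 then 2 * k else m - 1) fun i hi hvi => ?_
  have := h' i (hs i hi) hvi
  have := hs i hi
  split_ifs <;> omega

/-! ### Two odd closed walks sharing an edge -/

/-- Two closed walks of length `2 * k + 1` sharing an edge, joined by a diagonal. -/
theorem OddFree.not_adj_of_shared_edge [Fintype V] [DecidableRel G.Adj] {k : ℕ} (hk : 2 ≤ k)
    (hG : G.OddFree k) (hdeg : ∀ v, 3 * Fintype.card V < 4 * k * G.degree v) {F₁ F₂ : ℕ → V}
    (h₁ : G.IsClosedSeq (2 * k + 1) F₁) (h₂ : G.IsClosedSeq (2 * k + 1) F₂)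
    (h0 : F₁ 0 = F₂ 0) (hx : F₁ (2 * k) = F₂ (2 * k)) {m : ℕ} (hm : 1 ≤ m) (hm' : m < 2 * k)
    (hopt : 3 ≤ k ∨ (m = 2 * k - 2 ∧ G.Adj (F₁ (2 * k - 1)) (F₂ 1))) :
    ¬ G.Adj (F₁ m) (F₂ (2 * k - m)) := by
  intro hadj
  -- The ends of the shared edge are counted once: `(2k+1) + (2k-1) = 4k`.
  obtain ⟨v, hv⟩ := exists_four_le_card hdeg (Finset.range (2 * k + 1)) (Finset.Ico 1 (2 * k)) ∅ ∅
    F₁ F₂ F₁ F₁ (by omega) (by simp; omega)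
  have s1 : ∀ i ∈ Finset.range (2 * k + 1), i < 2 * k + 1 := by simp
  have s2 : ∀ i ∈ Finset.Ico 1 (2 * k), i < 2 * k + 1 := by
    intro i hi
    rw [Finset.mem_Ico] at hi
    omega
  have c1 := hG.card_filter_le_two hk h₁ v s1
  have c2 := hG.card_filter_le_two hk h₂ v s2
  simp only [Finset.filter_empty, Finset.card_empty, add_zero] at hv
  obtain ⟨μ, hμ, nμ⟩ := hG.exists_sits_of_two_le_card hk h₁ (v := v) s1 (by omega)
  obtain ⟨ν, hν, nν⟩ := hG.exists_sits_of_two_le_card hk h₂ (v := v) s2 (by omega)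
  -- Both neighbour positions on `F₂` are already used up off the shared edge. This rules out the
  -- exceptional positions in `sits_pair`.
  have key : ∀ i, i < 2 * k + 1 → (i < 1 ∨ 2 * k ≤ i) → ¬ G.Adj v (F₂ i) := by
    intro i hi hi' hvi
    have : ((Finset.Ico 1 (2 * k)).filter fun i => G.Adj v (F₂ i)).card ≤ 1 := by
      refine card_filter_le_one (if i = ν + 1 ∨ (ν = 2 * k ∧ i = 0) then ν - 1 else
        ν + 1) fun j hj hvj => ?_
      have := nν j (s2 j hj) hvj
      have := nν i hi hvi
      have := hν.lt
      rw [Finset.mem_Ico] at hj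
      split_ifs <;> omega
    omega
  have a0 := key 0 (by omega) (by omega)
  have ax := key (2 * k) (by omega) (by omega)
  have hμL := hμ.lt
  have hνL := hν.lt
  have bound : ∀ {F : ℕ → V} {p : ℕ}, G.Sits (2 * k + 1) F v p → G.IsClosedSeq (2 * k + 1) F →
      ¬ G.Adj v (F 0) → ¬ G.Adj v (F (2 * k)) → 2 ≤ p ∧ p ≤ 2 * k - 2 := by
    intro F p hp hF e0 ex
    have hlt := hp.lt
    have hcl := hF.closed
    have hne : p ≠ 0 := fun h => ex (hp.prev_zero h)
    have hp1 := hp.prev (by omega)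
    refine ⟨?_, ?_⟩
    · by_contra!
      obtain rfl : p = 1 := by omega
      exact e0 hp1
    · by_contra!
      rcases (by omega : p = 2 * k - 1 ∨ p = 2 * k) with h | h
      · apply ex
        have := hp.next
        rwa [show p + 1 = 2 * k by omega] at this
      · apply e0
        have := hp.next
        rwa [show p + 1 = 2 * k + 1 by omega, hcl] at this
  have bν := bound hν h₂ a0 ax
  have bμ := bound hμ h₁ (h0 ▸ a0) (hx ▸ ax)
  -- Reversal puts the shared edge at positions `0` and `1`, so that `sits_pair` applies with `ℓ =
  -- 1`.
  have e : 2 * k + 1 - μ = 2 * k + 1 - ν := by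
    have := hG.sits_pair hk h₁.reverse h₂.reverse (ℓ := 1) le_rfl (by omega)
      (by simp only [Nat.sub_zero, h₁.closed, h₂.closed, h0]) (by simpa using hx)
      (hμ.reverse (by omega)) (hν.reverse (by omega))
    omega
  obtain rfl : μ = ν := by omega
  have w1 : (μ = m ∧ G.HasWalk 2 v (F₁ m)) ∨ (μ < m ∧ G.HasWalk (m - μ) v (F₁ m)) ∨
      (m < μ ∧ G.HasWalk (μ - m) v (F₁ m)) := by
    rcases lt_trichotomy μ m with h | h | h
    · exact Or.inr (Or.inl ⟨h, hμ.walk_up h₁ h (by omega)⟩)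
    · subst h
      exact Or.inl ⟨rfl, hμ.walk_self h₁⟩
    · exact Or.inr (Or.inr ⟨h, hμ.walk_down h₁ h⟩)
  have w2 : (μ = 2 * k - m ∧ G.HasWalk 2 v (F₂ (2 * k - m))) ∨
      (μ < 2 * k - m ∧ G.HasWalk (2 * k - m - μ) v (F₂ (2 * k - m))) ∨
      (2 * k - m < μ ∧ G.HasWalk (μ - (2 * k - m)) v (F₂ (2 * k - m))) := by
    rcases lt_trichotomy μ (2 * k - m) with h | h | h
    · exact Or.inr (Or.inl ⟨h, hν.walk_up h₂ h (by omega)⟩)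
    · refine Or.inl ⟨h, ?_⟩
      rw [← h]
      exact hν.walk_self h₂
    · exact Or.inr (Or.inr ⟨h, hν.walk_down h₂ h⟩)
  -- Only here is the odd closed walk through `v` and the diagonal not too short: it has length `2 +
  -- 1 + 2 = 2k + 1`. The extra edge in `hopt` closes a triangle with `v` instead.
  have small : ¬ (k = 2 ∧ μ = 2 ∧ m = 2) := by
    rintro ⟨rfl, rfl, rfl⟩
    have e3 := (hopt.resolve_left (by omega)).2
    have := hG.le_add ((hμ.next.hasWalk).trans e3.hasWalk) (hν.prev (by omega)).hasWalk (by norm_num)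
    omega
  rcases w1 with ⟨_, w1⟩ | ⟨_, w1⟩ | ⟨_, w1⟩ <;> rcases w2 with ⟨_, w2⟩ | ⟨_, w2⟩ | ⟨_, w2⟩ <;>
  have w3 := hG.le_add (w1.trans hadj.hasWalk) w2 <;> clear hopt nν nμ <;> omega

/-! ### Rerouting closed walks, and `K₄`-subdivisions with three shortest odd faces -/

theorem Sits.isClosedSeq_update {L : ℕ} {F : ℕ → V} {v : V} {m : ℕ} (hF : G.IsClosedSeq L F)
    (h : G.Sits L F v m) (hm : 0 < m) :
    G.IsClosedSeq L fun i => if i = m then v else F i where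
  closed := by
    have := h.lt
    rw [if_neg (by omega), if_neg (by omega), hF.closed]
  adj i hi := by
    have h1 := h.next
    have h2 := h.prev hm
    by_cases e : i = m
    · subst e
      simpa using h1
    · by_cases e' : i + 1 = m
      · subst e'
        simpa using h2.symm
      · simpa [e, e'] using hF.adj i hi

/-- Follow `X` up to position `m`, where both closed walks are detoured through `v`,
and then follow `Y`. -/
theorem Sits.isClosedSeq_splice {L : ℕ} {X Y : ℕ → V} {v : V} {m : ℕ} (hX : G.IsClosedSeq L X)
    (hY : G.IsClosedSeq L Y) (h0 : X 0 = Y 0) (h : G.Sits L X v m) (h' : G.Sits L Y v m)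
    (hm : 0 < m) :
    G.IsClosedSeq L fun i => if i < m then X i else if i = m then v else Y i where
  closed := by
    have := h.lt
    rw [if_neg (by omega), if_neg (by omega), if_pos hm, hY.closed, h0]
  adj i hi := by
    have h1 := h'.next
    have h2 := h.prev hm
    rcases lt_trichotomy i m with e | e | e
    · by_cases e' : i + 1 = m
      · subst e'
        simpa using h2.symm
      · simpa [e, (by omega : i + 1 < m)] using hX.adj i hi
    · subst e
      simpa using h1
    · rw [if_neg (by omega), if_neg (by omega), if_neg (by omega), if_neg (by omega)]
      exact hY.adj i hi

/-- Three closed walks of length `2 * k + 1` through a common base point such that any two of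
them share an initial spoke; the spokes have lengths `α`, `β` and `γ`. -/
structure Tetra (G : SimpleGraph V) (k : ℕ) (C F₁ F₂ : ℕ → V) (α β γ : ℕ) : Prop where
  seq : G.IsClosedSeq (2 * k + 1) C
  seq₁ : G.IsClosedSeq (2 * k + 1) F₁
  seq₂ : G.IsClosedSeq (2 * k + 1) F₂
  eq₁ : ∀ i ≤ β, F₁ i = C i
  eq₂ : ∀ i ≤ γ, F₂ i = C (2 * k + 1 - i)
  eq₃ : ∀ i ≤ α, F₁ (2 * k + 1 - i) = F₂ (2 * k + 1 - i)
  one_le : 1 ≤ α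
  three_le : 3 ≤ β
  three_le' : 3 ≤ γ
  ab : α + β < 2 * k + 1
  ac : α + γ < 2 * k + 1
  bc : β + γ < 2 * k + 1

namespace Tetra
variable {k : ℕ} {C F₁ F₂ : ℕ → V} {α β γ : ℕ}

theorem swap (T : G.Tetra k C F₁ F₂ α β γ) :
    G.Tetra k (fun i => C (2 * k + 1 - i)) F₂ F₁ α γ β where
  seq := T.seq.reverse
  seq₁ := T.seq₂
  seq₂ := T.seq₁
  eq₁ := T.eq₂
  eq₂ i hi := by
    have := T.bc
    simp only [T.eq₁ i hi]
    congr 1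
    omega
  eq₃ i hi := (T.eq₃ i hi).symm
  one_le := T.one_le
  three_le := T.three_le'
  three_le' := T.three_le
  ab := T.ac
  ac := T.ab
  bc := by have := T.bc; omega

/-- The three arcs opposite the base point bound a fourth face, whose length `3(2k+1) - 2(α+β+γ)` is
odd. -/
theorem sum_le (T : G.Tetra k C F₁ F₂ α β γ) (hG : G.OddFree k) : α + β + γ ≤ 2 * k + 1 := by
  have h1 := T.ab
  have h2 := T.ac
  have h3 := T.bc
  have w1 := T.seq₁.hasWalk (i := β) (j := 2 * k + 1 - α) (by omega) (by omega)
  have w2 := T.seq₂.hasWalk (i := γ) (j := 2 * k + 1 - α) (by omega) (by omega)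
  have w3 := T.seq.hasWalk (i := β) (j := 2 * k + 1 - γ) (by omega) (by omega)
  rw [T.eq₁ β le_rfl, T.eq₃ α le_rfl] at w1
  rw [T.eq₂ γ le_rfl] at w2
  have := hG.le_add (w1.trans w2.symm) w3
  omega

/-- The shared spoke satisfies `3 ≤ β ≤ 2k - 3`, clear of every exceptional `ℓ` in `sits_pair`. -/
theorem sits_eq (T : G.Tetra k C F₁ F₂ α β γ) (hk : 2 ≤ k) (hG : G.OddFree k) {v : V} {m n : ℕ}
    (hm : G.Sits (2 * k + 1) C v m) (hn : G.Sits (2 * k + 1) F₁ v n) : m = n := by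
  have h1 := T.three_le
  have h2 := T.three_le'
  have h3 := T.bc
  have := hG.sits_pair hk T.seq T.seq₁ (ℓ := β) (by omega) (by omega) (T.eq₁ 0 (by omega)).symm
    (T.eq₁ β le_rfl).symm hm hn
  omega

/-- Reversing both faces puts the common spoke first. Its length `α` may be `1` or `2`, so
exceptions of `sits_pair` survive. -/
theorem sits_faces (T : G.Tetra k C F₁ F₂ α β γ) (hk : 2 ≤ k) (hG : G.OddFree k) {v : V} {m n : ℕ}
    (hm : G.Sits (2 * k + 1) F₁ v m) (hn : G.Sits (2 * k + 1) F₂ v n) :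
    m = n ∨ (α = 1 ∧ (m = 1 ∧ n = 2 * k ∨ m = 2 * k ∧ n = 1)) ∨
      (α ≤ 2 ∧ (m = 0 ∧ n = 2 * k - 1 ∨ m = 2 * k - 1 ∧ n = 0)) := by
  have h1 := T.three_le
  have h2 := T.three_le'
  have h3 := T.ab
  have h4 := T.one_le
  have hs := T.sum_le hG
  have hr : ∀ {F : ℕ → V} {p : ℕ}, G.Sits (2 * k + 1) F v p →
      ∃ q, G.Sits (2 * k + 1) (fun i => F (2 * k + 1 - i)) v q ∧
        (p = 0 ∧ q = 0 ∨ p + q = 2 * k + 1) := by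
    intro F p hp
    rcases Nat.eq_zero_or_pos p with rfl | h
    · exact ⟨0, hp.reverse_zero (by omega), by omega⟩
    · exact ⟨_, hp.reverse h, by have := hp.lt; omega⟩
  obtain ⟨m', hm', em⟩ := hr hm
  obtain ⟨n', hn', en⟩ := hr hn
  have := hG.sits_pair hk T.seq₁.reverse T.seq₂.reverse (ℓ := α) (by omega) (by omega)
    (T.eq₃ 0 (by omega)) (T.eq₃ α le_rfl) hm' hn'
  have := hm.lt
  have := hn.lt
  omega

/-- Rerouting `C` and `F₁` through `v` makes them agree up to `m`, which moves the end of the spoke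
`β` to `v` and leaves `F₂` untouched. -/
theorem extend (T : G.Tetra k C F₁ F₂ α β γ) {v : V} {m : ℕ} (hβ : β < m)
    (hγ : m < 2 * k + 1 - γ) (hα : m < 2 * k + 1 - α)
    (hC : G.Sits (2 * k + 1) C v m) (h₁ : G.Sits (2 * k + 1) F₁ v m) :
    ∃ C' F₁', G.Tetra k C' F₁' F₂ α m γ := by
  have t1 := T.three_le
  have t2 := T.one_le
  refine ⟨fun i => if i = m then v else C i,
    fun i => if i < m then C i else if i = m then v else F₁ i,
    hC.isClosedSeq_update T.seq (by omega),
    hC.isClosedSeq_splice T.seq T.seq₁ (T.eq₁ 0 (by omega)).symm h₁ (by omega),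
    T.seq₂, ?_, ?_, ?_, T.one_le, by omega, T.three_le', by omega, T.ac, by omega⟩
  · intro i hi
    by_cases e : i = m
    · simp [e]
    · simp [e, (by omega : i < m)]
  · intro i hi
    rw [T.eq₂ i hi, if_neg (by omega)]
  · intro i hi
    rw [if_neg (by omega), if_neg (by omega), T.eq₃ i hi]

/-- The counterpart of `extend` for the spoke `α`: the rerouted faces agree from position `m` to the
end. -/
theorem extend_faces (T : G.Tetra k C F₁ F₂ α β γ) {v : V} {m : ℕ} (hβ : β < m)
    (hγ : γ < m) (hα : m < 2 * k + 1 - α)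
    (h₁ : G.Sits (2 * k + 1) F₁ v m) (h₂ : G.Sits (2 * k + 1) F₂ v m) :
    ∃ F₁' F₂', G.Tetra k C F₁' F₂' (2 * k + 1 - m) β γ := by
  have t1 := T.three_le
  have t2 := T.one_le
  have t3 := T.bc
  have h0 : F₂ 0 = F₁ 0 := by
    rw [T.eq₁ 0 (by omega), T.eq₂ 0 (by omega)]
    exact T.seq.closed
  refine ⟨fun i => if i = m then v else F₁ i,
    fun i => if i < m then F₂ i else if i = m then v else F₁ i, T.seq,
    h₁.isClosedSeq_update T.seq₁ (by omega),
    h₂.isClosedSeq_splice T.seq₂ T.seq₁ h0 h₁ (by omega),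
    ?_, ?_, ?_, by omega, T.three_le, T.three_le', by omega, by omega, T.bc⟩
  · intro i hi
    rw [if_neg (by omega), T.eq₁ i hi]
  · intro i hi
    rw [if_pos (by omega), T.eq₂ i hi]
  · intro i hi
    by_cases e : 2 * k + 1 - i = m
    · simp [e]
    · rw [if_neg e, if_neg (by omega)]

end Tetra

/-- A vertex with two neighbours on one arc of a theta-like configuration and one neighbour on
each of the other two arcs forces the opposite spoke to be short. -/
theorem OddFree.spoke_le_two {k : ℕ} (hG : G.OddFree k) {v z a b c : V}
    {α β γ q q' s s' t t' : ℕ} (hβ : 2 ≤ β) (hγ : 2 ≤ γ)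
    (za : G.HasWalk α z a) (zb : G.HasWalk β z b) (zc : G.HasWalk γ z c)
    (vb : G.HasWalk q v b) (vc : G.HasWalk q' v c)
    (va : G.HasWalk (1 + s) v a) (vb' : G.HasWalk (1 + s') v b)
    (va' : G.HasWalk (1 + t) v a) (vc' : G.HasWalk (1 + t') v c)
    (eb : q + q' + β + γ = 2 * k + 1) (e₁ : s + s' + α + β = 2 * k + 1)
    (e₂ : t + t' + α + γ = 2 * k + 1) : α ≤ 2 := by
  -- Otherwise `h1` and `h2` bound two odd lengths of total `4k + 4 - 2β`, which is less than
  -- `2(2k+1)`.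
  have hb : (q + s') % 2 = 1 := by
    have h1 := hG.le_add vb vb'
    have h2 := hG.le_add (va.trans za.symm) (vc.trans zc.symm)
    by_contra h
    have h1 := h1 (by omega)
    have h2 := h2 (by omega)
    omega
  have hc : (q' + t') % 2 = 1 := by
    have h1 := hG.le_add vc vc'
    have h2 := hG.le_add (va'.trans za.symm) (vb.trans zb.symm)
    by_contra h
    have h1 := h1 (by omega)
    have h2 := h2 (by omega)
    omega
  have h4 := hG.le_add (va.trans za.symm) (vb.trans zb.symm) (by omega)
  have h5 := hG.le_add (va'.trans za.symm) (vc.trans zc.symm) (by omega)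
  have h6 := hG.le_add (vb'.trans zb.symm) (vc.trans zc.symm) (by omega)
  have h7 := hG.le_add (vc'.trans zc.symm) (vb.trans zb.symm) (by omega)
  -- Adding `h3`, `h6` and `h7` and substituting the three face lengths leaves `α ≤ 2`.
  have h3 := hG.le_add va va' (by omega)
  omega

/-! ### Where a vertex with four neighbour positions can sit -/

namespace Tetra
variable {k : ℕ} {C F₁ F₂ : ℕ → V} {α β γ : ℕ}

theorem base_eq (T : G.Tetra k C F₁ F₂ α β γ) : F₁ 0 = F₂ 0 := by
  rw [T.eq₁ 0 (by omega), T.eq₂ 0 (by omega)]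
  exact T.seq.closed.symm

theorem shared_edge (T : G.Tetra k C F₁ F₂ α β γ) : F₁ (2 * k) = F₂ (2 * k) := by
  simpa using T.eq₃ 1 T.one_le

/-- If `t + β` is odd, two closed walks give incompatible bounds on `t`. If it is even, the bounds
force `α = 1` and `t = 2k - β`; replacing `F₁ β` by `v` then creates the diagonal excluded by
`not_adj_of_shared_edge`. -/
theorem not_adj_of_sits_branch [Fintype V] [DecidableRel G.Adj] (hk : 2 ≤ k) (hG : G.OddFree k)
    (hdeg : ∀ v, 3 * Fintype.card V < 4 * k * G.degree v) (T : G.Tetra k C F₁ F₂ α β γ)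
    {v : V} {t : ℕ} (hC : G.Sits (2 * k + 1) C v β) (h₁ : G.Sits (2 * k + 1) F₁ v β)
    (ht : γ < t) (ht' : t < 2 * k + 1 - α) : ¬ G.Adj v (F₂ t) := by
  intro hvt
  have t1 := T.three_le
  have t2 := T.three_le'
  have t3 := T.one_le
  have t4 := T.ab
  have t5 := T.ac
  have t6 := T.bc
  have y0 := T.seq₂.hasWalk (i := 0) (j := t) (by omega) (by omega)
  have yc := T.seq₂.hasWalk (i := γ) (j := t) (by omega) (by omega)
  have ya := T.seq₂.hasWalk (i := t) (j := 2 * k + 1 - α) (by omega) (by omega)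
  rw [← T.base_eq, T.eq₁ 0 (by omega)] at y0
  rw [T.eq₂ γ le_rfl] at yc
  rw [← T.eq₃ α le_rfl] at ya
  have hαt : α = 1 ∧ t = 2 * k - β := by
    rcases Nat.mod_two_eq_zero_or_one (t + β) with e | e
    · have p0 := hG.le_add (hvt.hasWalk.trans y0.symm) (hC.walk_down T.seq (by omega)) (by omega)
      have pa := hG.le_add (hvt.hasWalk.trans ya) (h₁.walk_up T.seq₁ (by omega) (by omega))
        (by omega)
      omega
    · have p1 := hG.le_add (hvt.hasWalk.trans yc.symm)
        (hC.walk_up T.seq (by omega) (by omega)) (by omega)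
      have p2 := hG.le_add (hvt.hasWalk.trans ya)
        (h₁.walk_down_around T.seq₁ (by omega) (by omega)) (by omega)
      omega
  refine hG.not_adj_of_shared_edge hk hdeg (h₁.isClosedSeq_update T.seq₁ (by omega)) T.seq₂ ?_ ?_
    (m := β) (by omega) (by omega) (by omega) ?_
  · rw [if_neg (by omega), T.base_eq]
  · rw [if_neg (by omega), T.shared_edge]
  · rw [if_pos rfl, ← hαt.2]
    exact hvt

/-- The positions near which a vertex may be adjacent, given that it sits at `m`. -/
abbrev Near (k m t : ℕ) : Prop :=
  t = m + 1 ∨ t + 1 = m ∨ (m = 0 ∧ t = 2 * k) ∨ (m = 2 * k ∧ t = 0)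

set_option maxHeartbeats 1000000 in
-- The common position decides. Inside the spoke `α` or `γ` it gives two neighbours on `F₂`; past
-- `β` and inside both arcs it lengthens `β`; before `β` too few neighbours remain. The branch
-- positions are settled by parity and by the excluded diagonals.
theorem false_of_sits_left [Fintype V] [DecidableRel G.Adj] (hk : 2 ≤ k) (hG : G.OddFree k)
    (hdeg : ∀ v, 3 * Fintype.card V < 4 * k * G.degree v) (T : G.Tetra k C F₁ F₂ α β γ)
    (ih : ∀ C' F₁' m, β < m → ¬ G.Tetra k C' F₁' F₂ α m γ) {v : V} {m n : ℕ}
    (hC : G.Sits (2 * k + 1) C v m) (h₁ : G.Sits (2 * k + 1) F₁ v n)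
    (n₁ : ∀ t, t < 2 * k + 1 → G.Adj v (F₁ t) → Near k n t)
    (h₂ : ∀ i j, i < 2 * k + 1 → j < 2 * k + 1 → G.Adj v (F₂ i) → G.Adj v (F₂ j) → i = j)
    (hc : 2 ≤ ((Finset.Ico (β + 1) (2 * k + 1 - α)).filter fun i => G.Adj v (F₁ i)).card +
      ((Finset.Ico (γ + 1) (2 * k + 1 - α)).filter fun i => G.Adj v (F₂ i)).card +
      ((Finset.Ico (2 * k + 1 - α) (2 * k + 1)).filter fun i => G.Adj v (F₁ i)).card) : False := by
  obtain rfl := T.sits_eq hk hG hC h₁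
  have t1 := T.three_le
  have t2 := T.three_le'
  have t3 := T.one_le
  have t4 := T.ab
  have t5 := T.ac
  have t6 := T.bc
  have hs := T.sum_le hG
  have hm := hC.lt
  have hcl := T.seq.closed
  have h0 := T.base_eq
  have hx := T.shared_edge
  have CF : ∀ i, 2 * k + 1 - γ ≤ i → i ≤ 2 * k + 1 → G.Adj v (C i) →
      G.Adj v (F₂ (2 * k + 1 - i)) := by
    intro i hi hi' h
    rw [T.eq₂ _ (by omega), show 2 * k + 1 - (2 * k + 1 - i) = i by omega]
    exact h
  have FF : ∀ i, 2 * k + 1 - α ≤ i → i ≤ 2 * k + 1 → G.Adj v (F₁ i) → G.Adj v (F₂ i) := by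
    intro i hi hi' h
    have := T.eq₃ (2 * k + 1 - i) (by omega)
    rw [show 2 * k + 1 - (2 * k + 1 - i) = i by omega] at this
    rwa [← this]
  have c3 : ((Finset.Ico (γ + 1) (2 * k + 1 - α)).filter fun i => G.Adj v (F₂ i)).card ≤ 1 := by
    refine Finset.card_le_one.mpr fun i hi j hj => ?_
    rw [Finset.mem_filter, Finset.mem_Ico] at hi hj
    exact h₂ i j (by omega) (by omega) hi.2 hj.2
  rcases Nat.eq_zero_or_pos m with rfl | hm0
  · have a1 := CF _ (by omega) (by omega) (hC.prev_zero rfl)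
    have a2 := FF _ (by omega) (by omega) (h₁.prev_zero rfl)
    have := h₂ _ _ (by omega) (by omega) a1 a2
    omega
  have aC := hC.prev hm0
  have aC' := hC.next
  have aF := h₁.prev hm0
  have aF' := h₁.next
  by_cases g1 : 2 * k + 1 - γ < m
  · have := h₂ _ _ (by omega) (by omega) (CF _ (by omega) (by omega) aC)
      (CF _ (by omega) (by omega) aC')
    omega
  by_cases g2 : 2 * k + 1 - α < m
  · have a1 := FF _ (by omega) (by omega) aF
    have a2 := FF _ (by omega) (by omega) aF'
    by_cases e : m = 2 * k
    · subst e
      rw [T.seq₂.closed] at a2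
      have := h₂ _ _ (by omega) (by omega) a1 a2
      omega
    · have := h₂ _ _ (by omega) (by omega) a1 a2
      omega
  have wa : G.HasWalk (2 * k + 1 - α - γ) (F₁ (2 * k + 1 - α)) (C (2 * k + 1 - γ)) := by
    have := T.seq₂.hasWalk (i := γ) (j := 2 * k + 1 - α) (by omega) (by omega)
    rw [T.eq₂ γ le_rfl, ← T.eq₃ α le_rfl] at this
    exact this.symm
  by_cases g3 : m = 2 * k + 1 - γ
  · by_cases g4 : m = 2 * k + 1 - α
    · have := h₂ _ _ (by omega) (by omega) (CF _ (by omega) (by omega) aC')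
        (FF _ (by omega) (by omega) aF')
      omega
    · have w1 := hC.walk_self T.seq
      have w2 := h₁.walk_up T.seq₁ (i := 2 * k + 1 - α) (by omega) (by omega)
      rw [g3] at w1
      have := hG.le_add (w2.trans wa) w1
      -- The neighbour `C (m + 1)` lies on the spoke `γ`, where it equals `F₂ (2k - m)`; `v` takes
      -- the place of `F₁ m`.
      refine hG.not_adj_of_shared_edge hk hdeg (h₁.isClosedSeq_update T.seq₁ hm0) T.seq₂ ?_ ?_
        (m := m) (by omega) (by omega) (by omega) ?_
      · rw [if_neg (by omega), h0]
      · rw [if_neg (by omega), hx]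
      · rw [if_pos rfl, show 2 * k - m = 2 * k + 1 - (m + 1) by omega]
        exact CF _ (by omega) (by omega) aC'
  by_cases g4 : m = 2 * k + 1 - α
  · have w1 := h₁.walk_self T.seq₁
    have w2 := hC.walk_up T.seq (i := 2 * k + 1 - γ) (by omega) (by omega)
    rw [g4] at w1
    have := hG.le_add (w1.trans wa) w2
    omega
  by_cases g5 : β < m
  · obtain ⟨C', F', T'⟩ := T.extend g5 (by omega) (by omega) hC h₁
    exact ih C' F' m g5 T'
  have cS : ((Finset.Ico (2 * k + 1 - α) (2 * k + 1)).filter fun i => G.Adj v (F₁ i)).card ≤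
      if m = β ∧ m + 1 = 2 * k + 1 - α then 1 else 0 := by
    split_ifs with hif
    · refine card_filter_le_one (m + 1) fun i hi hvi => ?_
      rw [Finset.mem_Ico] at hi
      have := n₁ i (by omega) hvi
      omega
    · refine (card_filter_eq_zero fun i hi hvi => ?_).le
      rw [Finset.mem_Ico] at hi
      have := n₁ i (by omega) hvi
      omega
  have c2 : ((Finset.Ico (β + 1) (2 * k + 1 - α)).filter fun i => G.Adj v (F₁ i)).card ≤
      if m = β ∧ ¬ m + 1 = 2 * k + 1 - α then 1 else 0 := by
    split_ifs with hif
    · refine card_filter_le_one (m + 1) fun i hi hvi => ?_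
      rw [Finset.mem_Ico] at hi
      have := n₁ i (by omega) hvi
      omega
    · refine (card_filter_eq_zero fun i hi hvi => ?_).le
      rw [Finset.mem_Ico] at hi
      have := n₁ i (by omega) hvi
      omega
  have hmβ : m = β := by
    by_contra hne
    rw [if_neg (by omega)] at cS c2
    omega
  subst hmβ
  have c3' : 0 < ((Finset.Ico (γ + 1) (2 * k + 1 - α)).filter fun i => G.Adj v (F₂ i)).card := by
    split_ifs at cS c2 <;> omega
  obtain ⟨t, ht⟩ := Finset.card_pos.mp c3'
  rw [Finset.mem_filter, Finset.mem_Ico] at ht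
  obtain ⟨⟨ht1, ht2⟩, hvt⟩ := ht
  exact T.not_adj_of_sits_branch hk hG hdeg hC h₁ ht1 ht2 hvt

theorem adj_of_le (T : G.Tetra k C F₁ F₂ α β γ) {v : V} {i : ℕ} (hi : i ≤ β)
    (h : G.Adj v (F₁ i)) : G.Adj v (C i) := by
  rwa [← T.eq₁ i hi]

theorem adj_of_le' (T : G.Tetra k C F₁ F₂ α β γ) {v : V} {i : ℕ} (hi : i ≤ γ)
    (h : G.Adj v (F₂ i)) : G.Adj v (C (2 * k + 1 - i)) := by
  rwa [← T.eq₂ i hi]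

set_option maxHeartbeats 1000000 in
-- With a common position before the end of `β` or `γ` there are too many neighbours on `C`; inside
-- both arcs the spoke `α` grows; inside the spoke `α` the count falls short. At the far end of `α`,
-- the count forces a neighbour inside the remaining arc of `C`, and parity excludes it.
theorem false_of_sits_faces [DecidableRel G.Adj] (hk : 2 ≤ k) (hG : G.OddFree k)
    (T : G.Tetra k C F₁ F₂ α β γ)
    (ih : ∀ F₁' F₂' p, α < p → ¬ G.Tetra k C F₁' F₂' p β γ) {v : V} {m n : ℕ}
    (h₁ : G.Sits (2 * k + 1) F₁ v m) (h₂ : G.Sits (2 * k + 1) F₂ v n)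
    (n₁ : ∀ t, t < 2 * k + 1 → G.Adj v (F₁ t) → Near k m t)
    (n₂ : ∀ t, t < 2 * k + 1 → G.Adj v (F₂ t) → Near k n t)
    (hC : ∀ i j, i < 2 * k + 1 → j < 2 * k + 1 → G.Adj v (C i) → G.Adj v (C j) → i = j)
    (hc : 4 ≤ ((Finset.range (2 * k + 1)).filter fun i => G.Adj v (C i)).card +
      ((Finset.Ico (β + 1) (2 * k + 1 - α)).filter fun i => G.Adj v (F₁ i)).card +
      ((Finset.Ico (γ + 1) (2 * k + 1 - α)).filter fun i => G.Adj v (F₂ i)).card +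
      ((Finset.Ico (2 * k + 1 - α) (2 * k + 1)).filter fun i => G.Adj v (F₁ i)).card) : False := by
  have t1 := T.three_le
  have t2 := T.three_le'
  have t3 := T.one_le
  have t4 := T.ab
  have t5 := T.ac
  have t6 := T.bc
  have hs := T.sum_le hG
  have hmL := h₁.lt
  have hnL := h₂.lt
  have hcl := T.seq.closed
  have c1 : ((Finset.range (2 * k + 1)).filter fun i => G.Adj v (C i)).card ≤ 1 := by
    refine Finset.card_le_one.mpr fun i hi j hj => ?_
    rw [Finset.mem_filter, Finset.mem_range] at hi hj
    exact hC i j hi.1 hj.1 hi.2 hj.2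
  have c2 : ((Finset.Ico (β + 1) (2 * k + 1 - α)).filter fun i => G.Adj v (F₁ i)).card +
      ((Finset.Ico (2 * k + 1 - α) (2 * k + 1)).filter fun i => G.Adj v (F₁ i)).card ≤ 2 := by
    have := hG.card_filter_le_two hk T.seq₁ v (s := Finset.Ico (β + 1) (2 * k + 1))
      (by intro i hi; rw [Finset.mem_Ico] at hi; omega)
    rw [← Finset.Ico_union_Ico_eq_Ico (b := 2 * k + 1 - α) (by omega) (by omega),
      Finset.filter_union, Finset.card_union_of_disjoint] at this
    · exact this
    · exact Finset.disjoint_filter_filter (Finset.Ico_disjoint_Ico_consecutive _ _ _)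
  have hne : m ≠ 0 → n ≠ 0 → m = n := by
    intro hm hn
    rcases T.sits_faces hk hG h₁ h₂ with h | ⟨ha, ⟨rfl, rfl⟩ | ⟨rfl, rfl⟩⟩ | ⟨_, h⟩
    · exact h
    · have := hC _ _ (by omega) (by omega) (T.adj_of_le (by omega) (h₁.prev (by omega)))
        (T.adj_of_le (by omega) h₁.next)
      omega
    · have a1 := T.adj_of_le' (by omega) (h₂.prev (by omega))
      simp only [Nat.sub_self, Nat.sub_zero, hcl] at a1
      have := hC _ _ (by omega) (by omega) a1 (T.adj_of_le' (by omega) h₂.next)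
      omega
    · omega
  have hpos : m = n ∧ 0 < m := by
    rcases T.sits_faces hk hG h₁ h₂ with rfl | ⟨ha, h⟩ | ⟨ha, ⟨rfl, rfl⟩ | ⟨rfl, rfl⟩⟩
    · refine ⟨rfl, Nat.pos_of_ne_zero ?_⟩
      rintro rfl
      have := hC _ _ (by omega) (by omega) (T.adj_of_le (by omega) h₁.next)
        (T.adj_of_le' (by omega) h₂.next)
      omega
    · omega
    · have c2' : ((Finset.Ico (β + 1) (2 * k + 1 - α)).filter
          fun i => G.Adj v (F₁ i)).card ≤ 0 := by
        refine (card_filter_eq_zero fun i hi hvi => ?_).le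
        rw [Finset.mem_Ico] at hi
        have := n₁ i (by omega) hvi
        omega
      have cS : ((Finset.Ico (2 * k + 1 - α) (2 * k + 1)).filter
          fun i => G.Adj v (F₁ i)).card ≤ 1 := by
        refine card_filter_le_one (2 * k) fun i hi hvi => ?_
        rw [Finset.mem_Ico] at hi
        have := n₁ i (by omega) hvi
        omega
      have c3 : ((Finset.Ico (γ + 1) (2 * k + 1 - α)).filter
          fun i => G.Adj v (F₂ i)).card ≤ 1 := by
        refine card_filter_le_one (2 * k - 2) fun i hi hvi => ?_
        rw [Finset.mem_Ico] at hi
        have := n₂ i (by omega) hvi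
        omega
      omega
    · have c3 : ((Finset.Ico (γ + 1) (2 * k + 1 - α)).filter
          fun i => G.Adj v (F₂ i)).card ≤ 0 := by
        refine (card_filter_eq_zero fun i hi hvi => ?_).le
        rw [Finset.mem_Ico] at hi
        have := n₂ i (by omega) hvi
        omega
      omega
  obtain ⟨rfl, hm⟩ := hpos
  clear hne
  have aF := h₁.prev hm
  have aF' := h₁.next
  have bF := h₂.prev hm
  have bF' := h₂.next
  by_cases g1 : m < β
  · have := hC _ _ (by omega) (by omega) (T.adj_of_le (by omega) aF) (T.adj_of_le (by omega) aF')
    omega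
  by_cases g2 : m < γ
  · have a1 := T.adj_of_le' (by omega) bF
    have a2 := T.adj_of_le' (by omega) bF'
    by_cases e : m = 1
    · omega
    · have := hC _ _ (by omega) (by omega) a1 a2
      omega
  have bc := T.seq.hasWalk (i := β) (j := 2 * k + 1 - γ) (by omega) (by omega)
  by_cases g3 : m = β
  · by_cases g4 : m = γ
    · have := hC _ _ (by omega) (by omega) (T.adj_of_le (by omega) aF)
        (T.adj_of_le' (by omega) bF)
      omega
    · have w1 := h₁.walk_self T.seq₁
      have w2 := h₂.walk_down T.seq₂ (i := γ) (by omega)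
      rw [g3, T.eq₁ β le_rfl] at w1
      rw [T.eq₂ γ le_rfl] at w2
      have := hG.le_add (w1.trans bc) w2
      omega
  by_cases g4 : m = γ
  · have w1 := h₂.walk_self T.seq₂
    have w2 := h₁.walk_down T.seq₁ (i := β) (by omega)
    rw [g4, T.eq₂ γ le_rfl] at w1
    rw [T.eq₁ β le_rfl] at w2
    have := hG.le_add (w2.trans bc) w1
    omega
  by_cases g5 : m < 2 * k + 1 - α
  · obtain ⟨F₁', F₂', T'⟩ := T.extend_faces (by omega) (by omega) g5 h₁ h₂
    exact ih _ _ _ (by omega) T'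
  by_cases g6 : m = 2 * k + 1 - α
  swap
  · have c3 : ((Finset.Ico (γ + 1) (2 * k + 1 - α)).filter
        fun i => G.Adj v (F₂ i)).card ≤ 0 := by
      refine (card_filter_eq_zero fun i hi hvi => ?_).le
      rw [Finset.mem_Ico] at hi
      have := n₂ i (by omega) hvi
      omega
    omega
  have c3 : ((Finset.Ico (γ + 1) (2 * k + 1 - α)).filter
      fun i => G.Adj v (F₂ i)).card ≤ 1 := by
    refine card_filter_le_one (m - 1) fun i hi hvi => ?_
    rw [Finset.mem_Ico] at hi
    have := n₂ i (by omega) hvi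
    omega
  have hα : 2 ≤ α := by
    by_contra!
    have c2' : ((Finset.Ico (β + 1) (2 * k + 1 - α)).filter
        fun i => G.Adj v (F₁ i)).card ≤ 1 := by
      refine card_filter_le_one (m - 1) fun i hi hvi => ?_
      rw [Finset.mem_Ico] at hi
      have := n₁ i (by omega) hvi
      omega
    have cS : ((Finset.Ico (2 * k + 1 - α) (2 * k + 1)).filter
        fun i => G.Adj v (F₁ i)).card ≤ 0 := by
      refine (card_filter_eq_zero fun i hi hvi => ?_).le
      rw [Finset.mem_Ico] at hi
      have := n₁ i (by omega) hvi
      omega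
    omega
  have c1' : 0 < ((Finset.range (2 * k + 1)).filter fun i => G.Adj v (C i)).card := by omega
  obtain ⟨i, hi⟩ := Finset.card_pos.mp c1'
  rw [Finset.mem_filter, Finset.mem_range] at hi
  obtain ⟨hi, hvi⟩ := hi
  clear c1 c2 c3 c1' hc
  have i1 : β < i := by
    by_contra! h
    have := n₁ i hi (by rwa [T.eq₁ i h])
    omega
  have i2 : i < 2 * k + 1 - γ := by
    by_contra! h
    have := n₂ (2 * k + 1 - i) (by omega) (by
      rwa [T.eq₂ _ (by omega), show 2 * k + 1 - (2 * k + 1 - i) = i by omega])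
    omega
  have y0 := T.seq.hasWalk (i := 0) (j := i) (by omega) (by omega)
  have yb := T.seq.hasWalk (i := β) (j := i) (by omega) (by omega)
  have yc := T.seq.hasWalk (i := i) (j := 2 * k + 1 - γ) (by omega) (by omega)
  have v0 := h₁.walk_up_around T.seq₁ hm
  have v0' := h₁.walk_down T.seq₁ hm
  have vb := h₁.walk_down T.seq₁ (i := β) (by omega)
  have vb' := h₁.walk_up_around T.seq₁ (i := β) (by omega)
  have vc := h₂.walk_down T.seq₂ (i := γ) (by omega)
  have vc' := h₂.walk_up_around T.seq₂ (i := γ) (by omega)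
  rw [T.eq₁ _ (by omega)] at v0 v0' vb vb'
  rw [T.eq₂ _ (by omega)] at vc vc'
  have := hG.le_add (hvi.hasWalk.trans y0.symm) v0
  have := hG.le_add (hvi.hasWalk.trans y0.symm) v0'
  have := hG.le_add (hvi.hasWalk.trans yb.symm) vb
  have := hG.le_add (hvi.hasWalk.trans yb.symm) vb'
  have := hG.le_add (hvi.hasWalk.trans yc) vc
  have := hG.le_add (hvi.hasWalk.trans yc) vc'
  omega

/-- A vertex with two neighbours on the second arc and one neighbour on each other arc. -/
theorem false_of_arc (T : G.Tetra k C F₁ F₂ α β γ) (hG : G.OddFree k)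
    {v : V} {m i s : ℕ} (hα : 2 ≤ α) (h₁ : G.Sits (2 * k + 1) F₁ v m) (hm : β < m)
    (hm' : m < 2 * k + 1 - α) (hi : β < i) (hi' : i < 2 * k + 1 - γ) (hvi : G.Adj v (C i))
    (hs : γ < s) (hs' : s < 2 * k + 1 - α) (hvs : G.Adj v (F₂ s)) : False := by
  have t1 := T.three_le
  have t2 := T.three_le'
  have t4 := T.ab
  have t5 := T.ac
  have t6 := T.bc
  have hcl := T.seq.closed
  have za := (T.seq₁.hasWalk (i := 2 * k + 1 - α) (j := 2 * k + 1) (by omega) le_rfl).symm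
  rw [T.seq₁.closed, T.eq₁ 0 (by omega)] at za
  have zb := T.seq.hasWalk (i := 0) (j := β) (by omega) (by omega)
  have zc := (T.seq.hasWalk (i := 2 * k + 1 - γ) (j := 2 * k + 1) (by omega) le_rfl).symm
  rw [hcl] at zc
  have va := h₁.walk_up T.seq₁ hm' (by omega)
  have vb := h₁.walk_down T.seq₁ hm
  rw [T.eq₁ _ le_rfl] at vb
  have vb' := hvi.hasWalk.trans (T.seq.hasWalk (i := β) (j := i) (by omega) (by omega)).symm
  have vc := hvi.hasWalk.trans
    (T.seq.hasWalk (i := i) (j := 2 * k + 1 - γ) (by omega) (by omega))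
  have vc' := hvs.hasWalk.trans (T.seq₂.hasWalk (i := γ) (j := s) (by omega) (by omega)).symm
  have va' := hvs.hasWalk.trans
    (T.seq₂.hasWalk (i := s) (j := 2 * k + 1 - α) (by omega) (by omega))
  rw [T.eq₂ _ le_rfl] at vc'
  rw [← T.eq₃ _ le_rfl] at va'
  -- The spokes are permuted cyclically, so the conclusion is `γ ≤ 2`, against `3 ≤ γ`.
  have := hG.spoke_le_two (α := γ) (β := α) (γ := β) (q := 2 * k + 1 - α - m) (q' := m - β)
    (s := s - γ) (s' := 2 * k + 1 - α - s) (t := 2 * k + 1 - γ - i) (t' := i - β) hα (by omega)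
    (zc.congr (by omega)) (za.congr (by omega)) zb va vb vc' va' vc vb'
    (by omega) (by omega) (by omega)
  omega

/-- A vertex with two neighbours on the first arc and one neighbour on each other arc. -/
theorem le_two_of_arc (T : G.Tetra k C F₁ F₂ α β γ) (hG : G.OddFree k)
    {v : V} {m t s : ℕ} (hC : G.Sits (2 * k + 1) C v m) (hm : β < m)
    (hm' : m < 2 * k + 1 - γ) (ht : β < t) (ht' : t < 2 * k + 1 - α) (hvt : G.Adj v (F₁ t))
    (hs : γ < s) (hs' : s < 2 * k + 1 - α) (hvs : G.Adj v (F₂ s)) : α ≤ 2 := by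
  have t1 := T.three_le
  have t2 := T.three_le'
  have t4 := T.ab
  have t5 := T.ac
  have t6 := T.bc
  have hcl := T.seq.closed
  have za := (T.seq₁.hasWalk (i := 2 * k + 1 - α) (j := 2 * k + 1) (by omega) le_rfl).symm
  rw [T.seq₁.closed, T.eq₁ 0 (by omega)] at za
  have zb := T.seq.hasWalk (i := 0) (j := β) (by omega) (by omega)
  have zc := (T.seq.hasWalk (i := 2 * k + 1 - γ) (j := 2 * k + 1) (by omega) le_rfl).symm
  rw [hcl] at zc
  have vb := hC.walk_down T.seq hm
  have vc := hC.walk_up T.seq hm' (by omega)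
  have vb' := hvt.hasWalk.trans (T.seq₁.hasWalk (i := β) (j := t) (by omega) (by omega)).symm
  have va := hvt.hasWalk.trans
    (T.seq₁.hasWalk (i := t) (j := 2 * k + 1 - α) (by omega) (by omega))
  have vc' := hvs.hasWalk.trans (T.seq₂.hasWalk (i := γ) (j := s) (by omega) (by omega)).symm
  have va' := hvs.hasWalk.trans
    (T.seq₂.hasWalk (i := s) (j := 2 * k + 1 - α) (by omega) (by omega))
  rw [T.eq₁ _ le_rfl] at vb'
  rw [T.eq₂ _ le_rfl] at vc'
  rw [← T.eq₃ _ le_rfl] at va'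
  exact hG.spoke_le_two (α := α) (β := β) (γ := γ) (q := m - β) (q' := 2 * k + 1 - γ - m)
    (s := 2 * k + 1 - α - t) (s' := t - β) (t := 2 * k + 1 - α - s) (t' := s - γ)
    (by omega) (by omega) (za.congr (by omega)) (zb.congr (by omega)) (zc.congr (by omega))
    vb vc va vb' va' vc' (by omega) (by omega) (by omega)

theorem card_filter_Ico_add {a b c : ℕ} (p : ℕ → Prop) [DecidablePred p] (hab : a ≤ b)
    (hbc : b ≤ c) : ((Finset.Ico a b).filter p).card + ((Finset.Ico b c).filter p).card =
      ((Finset.Ico a c).filter p).card := by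
  rw [← Finset.Ico_union_Ico_eq_Ico hab hbc, Finset.filter_union, Finset.card_union_of_disjoint]
  exact Finset.disjoint_filter_filter (Finset.Ico_disjoint_Ico_consecutive _ _ _)

theorem exists_pair_of_two_le_card {s : Finset ℕ} {p : ℕ → Prop} [DecidablePred p]
    (h : 2 ≤ (s.filter p).card) : ∃ i j, i < j ∧ i ∈ s ∧ j ∈ s ∧ p i ∧ p j := by
  obtain ⟨i, hi, j, hj, hij⟩ := Finset.one_lt_card.mp h
  rw [Finset.mem_filter] at hi hj
  rcases lt_or_gt_of_ne hij with h | h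
  · exact ⟨i, j, h, hi.1, hj.1, hi.2, hj.2⟩
  · exact ⟨j, i, h, hj.1, hi.1, hj.2, hi.2⟩

/-- The vertex `v` is adjacent to at most one position of the closed walk `F`. -/
abbrev AtMostOne (G : SimpleGraph V) (k : ℕ) (F : ℕ → V) (v : V) : Prop :=
  ∀ i j, i < 2 * k + 1 → j < 2 * k + 1 → G.Adj v (F i) → G.Adj v (F j) → i = j

theorem AtMostOne.card_le [DecidableRel G.Adj] {F : ℕ → V} {v : V} (h : AtMostOne G k F v)
    {s : Finset ℕ} (hs : ∀ i ∈ s, i < 2 * k + 1) :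
    (s.filter fun i => G.Adj v (F i)).card ≤ 1 := by
  refine Finset.card_le_one.mpr fun i hi j hj => ?_
  rw [Finset.mem_filter] at hi hj
  exact h i j (hs i hi.1) (hs j hj.1) hi.2 hj.2

theorem AtMostOne.reverse {F : ℕ → V} {v : V} (h : AtMostOne G k F v)
    (hF : G.IsClosedSeq (2 * k + 1) F) : AtMostOne G k (fun i => F (2 * k + 1 - i)) v := by
  have key : ∀ i, i < 2 * k + 1 → G.Adj v (F (2 * k + 1 - i)) →
      ∃ i', i' < 2 * k + 1 ∧ (i = 0 ∧ i' = 0 ∨ i + i' = 2 * k + 1) ∧ G.Adj v (F i') := by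
    intro i hi hvi
    rcases Nat.eq_zero_or_pos i with rfl | h0
    · rw [Nat.sub_zero, hF.closed] at hvi
      exact ⟨0, by omega, by omega, hvi⟩
    · exact ⟨_, by omega, by omega, hvi⟩
  intro i j hi hj hvi hvj
  obtain ⟨i', a1, a2, a3⟩ := key i hi hvi
  obtain ⟨j', b1, b2, b3⟩ := key j hj hvj
  have := h i' j' a1 b1 a3 b3
  omega

theorem exists_sits_or_atMostOne (hk : 2 ≤ k) (hG : G.OddFree k) {F : ℕ → V}
    (hF : G.IsClosedSeq (2 * k + 1) F) (v : V) :
    (∃ m, G.Sits (2 * k + 1) F v m ∧ ∀ t, t < 2 * k + 1 → G.Adj v (F t) → Near k m t) ∨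
      AtMostOne G k F v := by
  by_contra h
  obtain ⟨h1, h2⟩ := not_or.mp h
  unfold AtMostOne at h2
  push Not at h1 h2
  obtain ⟨i, j, hi, hj, hvi, hvj, hij⟩ := h2
  obtain ⟨m, hm, hm'⟩ := hG.sits_of_adj hk hF hij hi hj hvi hvj
  obtain ⟨t, ht, ht', hn⟩ := h1 m hm
  have := hm' t ht ht'
  omega

theorem exists_sits_reverse {F : ℕ → V} (hk : 2 ≤ k) {v : V} {p : ℕ}
    (hp : G.Sits (2 * k + 1) F v p) :
    ∃ q, G.Sits (2 * k + 1) (fun i => F (2 * k + 1 - i)) v q ∧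
      (p = 0 ∧ q = 0 ∨ p + q = 2 * k + 1) := by
  rcases Nat.eq_zero_or_pos p with rfl | h
  · exact ⟨0, hp.reverse_zero (by omega), by omega⟩
  · exact ⟨_, hp.reverse h, by have := hp.lt; omega⟩

theorem adj_left (T : G.Tetra k C F₁ F₂ α β γ) {v : V} {i : ℕ} (hi : i ≤ β)
    (h : G.Adj v (C i)) : G.Adj v (F₁ i) := by
  rwa [T.eq₁ i hi]

theorem adj_right (T : G.Tetra k C F₁ F₂ α β γ) {v : V} {i : ℕ} (hi : 2 * k + 1 - γ ≤ i)
    (hi' : i < 2 * k + 1) (h : G.Adj v (C i)) : G.Adj v (F₂ (2 * k + 1 - i)) := by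
  have := T.three_le'
  rwa [T.eq₂ _ (by omega), show 2 * k + 1 - (2 * k + 1 - i) = i by omega]

theorem card_spoke [DecidableRel G.Adj] (T : G.Tetra k C F₁ F₂ α β γ) (v : V) :
    ((Finset.Ico (2 * k + 1 - α) (2 * k + 1)).filter fun i => G.Adj v (F₁ i)).card =
      ((Finset.Ico (2 * k + 1 - α) (2 * k + 1)).filter fun i => G.Adj v (F₂ i)).card := by
  refine congrArg _ (Finset.filter_congr fun i hi => ?_)
  rw [Finset.mem_Ico] at hi
  have := T.eq₃ (2 * k + 1 - i) (by omega)
  rw [show 2 * k + 1 - (2 * k + 1 - i) = i by omega] at this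
  rw [this]

/-- A vertex which sits on all three faces has at most one neighbour position outside the
first face. -/
theorem card_arcs_le_one_of_sits [DecidableRel G.Adj] (T : G.Tetra k C F₁ F₂ α β γ) (hk : 2 ≤ k)
    (hG : G.OddFree k) {v : V} {p m n : ℕ} (hC : G.Sits (2 * k + 1) C v p)
    (h₁ : G.Sits (2 * k + 1) F₁ v m) (h₂ : G.Sits (2 * k + 1) F₂ v n)
    (n₁ : ∀ t, t < 2 * k + 1 → G.Adj v (F₁ t) → Near k m t)
    (n₂ : ∀ t, t < 2 * k + 1 → G.Adj v (F₂ t) → Near k n t) :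
    ((Finset.Ico (β + 1) (2 * k + 1 - α)).filter fun i => G.Adj v (F₁ i)).card +
      ((Finset.Ico (γ + 1) (2 * k + 1 - α)).filter fun i => G.Adj v (F₂ i)).card +
      ((Finset.Ico (2 * k + 1 - α) (2 * k + 1)).filter fun i => G.Adj v (F₁ i)).card ≤ 1 := by
  have t1 := T.three_le
  have t2 := T.three_le'
  have t3 := T.one_le
  have t4 := T.ab
  have t5 := T.ac
  have t6 := T.bc
  obtain rfl := T.sits_eq hk hG hC h₁
  obtain ⟨q, hq, hpq⟩ := exists_sits_reverse hk hC
  obtain rfl := T.swap.sits_eq hk hG hq h₂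
  -- The position on `F₂` is the mirror image of `p`. As `2k+1` is odd, it equals `p` only at the
  -- base point; the rest are exceptions from `sits_faces`.
  have hpos : (p = 0 ∧ q = 0) ∨ (α = 1 ∧ p = 1 ∧ q = 2 * k) ∨ (α = 1 ∧ p = 2 * k ∧ q = 1) := by
    have := T.sits_faces hk hG h₁ h₂
    omega
  have e1 := card_filter_Ico_add (fun i => G.Adj v (F₁ i)) (a := β + 1) (b := 2 * k + 1 - α)
    (c := 2 * k + 1) (by omega) (by omega)
  have e2 := card_filter_Ico_add (fun i => G.Adj v (F₂ i)) (a := γ + 1) (b := 2 * k + 1 - α)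
    (c := 2 * k + 1) (by omega) (by omega)
  rcases hpos with ⟨rfl, rfl⟩ | ⟨rfl, rfl, rfl⟩ | ⟨rfl, rfl, rfl⟩
  · have c1 : ((Finset.Ico (β + 1) (2 * k + 1)).filter fun i => G.Adj v (F₁ i)).card ≤ 1 := by
      refine card_filter_le_one (2 * k) fun i hi hvi => ?_
      rw [Finset.mem_Ico] at hi
      have := n₁ i (by omega) hvi
      omega
    have c2 : ((Finset.Ico (γ + 1) (2 * k + 1 - α)).filter
        fun i => G.Adj v (F₂ i)).card = 0 := by
      refine card_filter_eq_zero fun i hi hvi => ?_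
      rw [Finset.mem_Ico] at hi
      have := n₂ i (by omega) hvi
      omega
    omega
  · have c1 : ((Finset.Ico (β + 1) (2 * k + 1)).filter fun i => G.Adj v (F₁ i)).card = 0 := by
      refine card_filter_eq_zero fun i hi hvi => ?_
      rw [Finset.mem_Ico] at hi
      have := n₁ i (by omega) hvi
      omega
    have c2 : ((Finset.Ico (γ + 1) (2 * k + 1 - 1)).filter
        fun i => G.Adj v (F₂ i)).card ≤ 1 := by
      refine card_filter_le_one (2 * k - 1) fun i hi hvi => ?_
      rw [Finset.mem_Ico] at hi
      have := n₂ i (by omega) hvi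
      omega
    omega
  · have c1 : ((Finset.Ico (β + 1) (2 * k + 1)).filter fun i => G.Adj v (F₁ i)).card ≤ 1 := by
      refine card_filter_le_one (2 * k - 1) fun i hi hvi => ?_
      rw [Finset.mem_Ico] at hi
      have := n₁ i (by omega) hvi
      omega
    have c2 : ((Finset.Ico (γ + 1) (2 * k + 1 - 1)).filter
        fun i => G.Adj v (F₂ i)).card = 0 := by
      refine card_filter_eq_zero fun i hi hvi => ?_
      rw [Finset.mem_Ico] at hi
      have := n₂ i (by omega) hvi
      omega
    omega

theorem sits_mem_arc {F : ℕ → V} {v : V} {m a b i j : ℕ} (ha : 3 ≤ a)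
    (hb : b ≤ 2 * k + 1) (hn : ∀ t, t < 2 * k + 1 → G.Adj v (F t) → Near k m t)
    (hij : i < j) (hi : a < i) (hj : j < b) (hvi : G.Adj v (F i)) (hvj : G.Adj v (F j)) :
    i + 1 = m ∧ j = m + 1 := by
  have := hn i (by omega) hvi
  have := hn j (by omega) hvj
  omega

/-- The case of a vertex which sits on the second face only. -/
theorem false_of_sits_one [DecidableRel G.Adj] (T : G.Tetra k C F₁ F₂ α β γ)
    (hG : G.OddFree k) {v : V} {m i : ℕ} (h₁ : G.Sits (2 * k + 1) F₁ v m)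
    (n₁ : ∀ t, t < 2 * k + 1 → G.Adj v (F₁ t) → Near k m t) (u₂ : AtMostOne G k F₂ v)
    (hi : i < 2 * k + 1) (hvi : G.Adj v (C i)) (hα : β < i → i < 2 * k + 1 - γ → 2 ≤ α)
    (hc : 2 ≤ ((Finset.Ico (β + 1) (2 * k + 1 - α)).filter fun i => G.Adj v (F₁ i)).card)
    (hc' : 1 ≤ ((Finset.Ico (γ + 1) (2 * k + 1 - α)).filter fun i => G.Adj v (F₂ i)).card) :
    False := by
  have t1 := T.three_le
  have t2 := T.three_le'
  have t3 := T.one_le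
  obtain ⟨p, q, hpq, hp, hq, hvp, hvq⟩ := exists_pair_of_two_le_card hc
  obtain ⟨s, hs⟩ := Finset.card_pos.mp hc'
  rw [Finset.mem_filter, Finset.mem_Ico] at hs
  rw [Finset.mem_Ico] at hp hq
  have hpm := sits_mem_arc t1 (b := 2 * k + 1 - α) (by omega) n₁ hpq (by omega) (by omega) hvp hvq
  have i1 : β < i := by
    by_contra! h
    have := n₁ i hi (T.adj_left h hvi)
    omega
  have i2 : i < 2 * k + 1 - γ := by
    by_contra! h
    have := u₂ _ s (by omega) (by omega) (T.adj_right h hi hvi) hs.2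
    omega
  exact T.false_of_arc hG (hα i1 i2) h₁ (by omega) (by omega) i1 i2 hvi (by omega) (by omega) hs.2

/-- The case of a vertex which sits on the first face only. -/
theorem false_of_sits_base [DecidableRel G.Adj] (T : G.Tetra k C F₁ F₂ α β γ)
    (hG : G.OddFree k) {v : V} {p i j : ℕ} (hC : G.Sits (2 * k + 1) C v p)
    (nC : ∀ t, t < 2 * k + 1 → G.Adj v (C t) → Near k p t)
    (u₁ : AtMostOne G k F₁ v) (u₂ : AtMostOne G k F₂ v)
    (hij : i < j) (hj : j < 2 * k + 1) (hvi : G.Adj v (C i)) (hvj : G.Adj v (C j))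
    (hj' : j < β + α ∨ 2 * k + 1 - γ ≤ j)
    (hc : 1 ≤ ((Finset.Ico (β + 1) (2 * k + 1 - α)).filter fun i => G.Adj v (F₁ i)).card)
    (hc' : 1 ≤ ((Finset.Ico (γ + 1) (2 * k + 1 - α)).filter fun i => G.Adj v (F₂ i)).card) :
    False := by
  have t1 := T.three_le
  have t2 := T.three_le'
  have t3 := T.one_le
  have hs := T.sum_le hG
  obtain ⟨t, ht⟩ := Finset.card_pos.mp hc
  obtain ⟨s, hs⟩ := Finset.card_pos.mp hc'
  rw [Finset.mem_filter, Finset.mem_Ico] at ht hs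
  have key : ∀ i, i < 2 * k + 1 → G.Adj v (C i) → β < i ∧ i < 2 * k + 1 - γ := by
    intro i hi hvi
    constructor
    · by_contra! h
      have := u₁ i t hi (by omega) (T.adj_left h hvi) ht.2
      omega
    · by_contra! h
      have := u₂ _ s (by omega) (by omega) (T.adj_right h hi hvi) hs.2
      omega
  have a1 := key i (by omega) hvi
  have a2 := key j hj hvj
  have hpm := sits_mem_arc t1 (b := 2 * k + 1 - γ) (by omega) nC hij a1.1 a2.2 hvi hvj
  -- The counted positions below `β + α` reach only `α - 1 ≤ 1` steps into the arc, so two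
  -- neighbours at distance two do not fit.
  have := T.le_two_of_arc hG hC (by omega) (by omega) (by omega) (by omega) ht.2 (by omega)
    (by omega) hs.2
  omega

end Tetra

/-- Induction on the slack in `Tetra.sum_le`, so that the spokes may be assumed of maximal total
length; the cases are the subsets of faces on which the counted vertex sits. -/
theorem OddFree.not_tetra [Fintype V] [DecidableRel G.Adj] {k : ℕ} (hk : 2 ≤ k) (hG : G.OddFree k)
    (hdeg : ∀ v, 3 * Fintype.card V < 4 * k * G.degree v) {C F₁ F₂ : ℕ → V} {α β γ : ℕ} :
    ¬ G.Tetra k C F₁ F₂ α β γ := by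
  induction h : 2 * k + 1 - (α + β + γ) using Nat.strong_induction_on
    generalizing C F₁ F₂ α β γ with
  | _ n ih =>
  intro T
  have ih : ∀ C' F₁' F₂' α' β' γ', α + β + γ < α' + β' + γ' →
      ¬ G.Tetra k C' F₁' F₂' α' β' γ' := by
    intro C' F₁' F₂' α' β' γ' hlt T'
    have := T'.sum_le hG
    exact ih _ (by omega) rfl T'
  clear h
  have t1 := T.three_le
  have t2 := T.three_le'
  have t3 := T.one_le
  have t4 := T.ab
  have t5 := T.ac
  have t6 := T.bc
  have hs := T.sum_le hG
  -- The spokes with the base point give `α + β + γ + 1` positions, the arcs of `F₁` and `F₂` give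
  -- `4k - 2α - β - γ`, and `α - 1` further positions on the arc of `C` bring the total to `4k`.
  obtain ⟨v, hv⟩ := exists_four_le_card hdeg
    (Finset.range (β + α) ∪ Finset.Ico (2 * k + 1 - γ) (2 * k + 1))
    (Finset.Ico (β + 1) (2 * k + 1 - α)) (Finset.Ico (γ + 1) (2 * k + 1 - α))
    (Finset.Ico (2 * k + 1 - α) (2 * k + 1)) C F₁ F₂ F₁ (by omega) (by
      rw [Finset.card_union_of_disjoint]
      · simp only [Finset.card_range, Nat.card_Ico]
        omega
      · rw [Finset.disjoint_left]
        intro i hi hi'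
        rw [Finset.mem_range] at hi
        rw [Finset.mem_Ico] at hi'
        omega)
  have sC : ∀ i ∈ Finset.range (β + α) ∪ Finset.Ico (2 * k + 1 - γ) (2 * k + 1),
      i < 2 * k + 1 ∧ (i < β + α ∨ 2 * k + 1 - γ ≤ i) := by
    intro i hi
    rw [Finset.mem_union, Finset.mem_range, Finset.mem_Ico] at hi
    omega
  have s1 : ∀ a, ∀ i ∈ Finset.Ico a (2 * k + 1), i < 2 * k + 1 := by
    intro a i hi
    rw [Finset.mem_Ico] at hi
    exact hi.2
  have e1 := Tetra.card_filter_Ico_add (fun i => G.Adj v (F₁ i)) (a := β + 1)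
    (b := 2 * k + 1 - α) (c := 2 * k + 1) (by omega) (by omega)
  have e2 := Tetra.card_filter_Ico_add (fun i => G.Adj v (F₂ i)) (a := γ + 1)
    (b := 2 * k + 1 - α) (c := 2 * k + 1) (by omega) (by omega)
  have e3 := T.card_spoke v
  have cC := hG.card_filter_le_two hk T.seq v fun i hi => (sC i hi).1
  have c1 := hG.card_filter_le_two hk T.seq₁ v (s1 (β + 1))
  have c2 := hG.card_filter_le_two hk T.seq₂ v (s1 (γ + 1))
  rcases Tetra.exists_sits_or_atMostOne hk hG T.seq v with ⟨p, hp, np⟩ | uC <;>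
  rcases Tetra.exists_sits_or_atMostOne hk hG T.seq₁ v with ⟨m, hm, nm⟩ | u1 <;>
  rcases Tetra.exists_sits_or_atMostOne hk hG T.seq₂ v with ⟨n, hn, nn⟩ | u2
  · have := T.card_arcs_le_one_of_sits hk hG hp hm hn nm nn
    omega
  · exact T.false_of_sits_left hk hG hdeg (fun C' F' m hm => ih _ _ _ _ _ _ (by omega)) hp hm nm u2
      (by omega)
  · obtain ⟨q, hq, hpq⟩ := Tetra.exists_sits_reverse hk hp
    exact T.swap.false_of_sits_left hk hG hdeg
      (fun C' F' m hm T' => ih _ _ _ _ _ _ (by omega) T'.swap) hq hn nn u1 (by omega)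
  · have c1' := u1.card_le (s1 (β + 1))
    have c2' := u2.card_le (s1 (γ + 1))
    obtain ⟨i, j, hij, hi, hj, hvi, hvj⟩ := Tetra.exists_pair_of_two_le_card
      (show 2 ≤ _ by omega : 2 ≤ ((Finset.range (β + α) ∪
        Finset.Ico (2 * k + 1 - γ) (2 * k + 1)).filter fun i => G.Adj v (C i)).card)
    exact T.false_of_sits_base hG hp np u1 u2 hij (sC j hj).1 hvi hvj (sC j hj).2
      (by omega) (by omega)
  · refine T.false_of_sits_faces hk hG (fun F₁' F₂' p hp => ih _ _ _ _ _ _ (by omega)) hm hn nm nn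
      uC (hv.trans ?_)
    gcongr
    intro i hi
    exact Finset.mem_range.mpr (sC i hi).1
  · have cC' := uC.card_le fun i hi => (sC i hi).1
    have c2' := u2.card_le (s1 (γ + 1))
    obtain ⟨i, hi⟩ := Finset.card_pos.mp
      (show 0 < _ by omega : 0 < ((Finset.range (β + α) ∪
        Finset.Ico (2 * k + 1 - γ) (2 * k + 1)).filter fun i => G.Adj v (C i)).card)
    rw [Finset.mem_filter] at hi
    have := sC i hi.1
    exact T.false_of_sits_one hG hm nm u2 this.1 hi.2 (by omega) (by omega) (by omega)
  · have cC' := uC.card_le fun i hi => (sC i hi).1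
    have c1' := u1.card_le (s1 (β + 1))
    obtain ⟨i, hi⟩ := Finset.card_pos.mp
      (show 0 < _ by omega : 0 < ((Finset.range (β + α) ∪
        Finset.Ico (2 * k + 1 - γ) (2 * k + 1)).filter fun i => G.Adj v (C i)).card)
    rw [Finset.mem_filter] at hi
    have := sC i hi.1
    have hi0 : i ≠ 0 := by
      rintro rfl
      obtain ⟨t, ht⟩ := Finset.card_pos.mp (show 0 < _ by omega :
        0 < ((Finset.Ico (β + 1) (2 * k + 1 - α)).filter fun i => G.Adj v (F₁ i)).card)
      rw [Finset.mem_filter, Finset.mem_Ico] at ht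
      have := u1 0 t (by omega) (by omega) (T.adj_left (by omega) hi.2) ht.2
      omega
    exact T.swap.false_of_sits_one hG hn nn u1 (i := 2 * k + 1 - i) (by omega)
      (by rw [show 2 * k + 1 - (2 * k + 1 - i) = i by omega]; exact hi.2)
      (by omega) (by omega) (by omega)
  · have cC' := uC.card_le fun i hi => (sC i hi).1
    have c1' := u1.card_le (s1 (β + 1))
    have c2' := u2.card_le (s1 (γ + 1))
    omega

/-! ### From one neighbour on `C` to sitting on `C` -/

variable {k : ℕ}

theorem exists_detour [Fintype V] [DecidableRel G.Adj] (hk : 2 ≤ k) (hG : G.OddFree k)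
    (hdeg : ∀ v, 3 * Fintype.card V < 4 * k * G.degree v)
    (hmax : ∀ x y, x ≠ y → ¬ G.Adj x y → ∃ n, n % 2 = 0 ∧ n ≤ 2 * k - 2 ∧ G.HasWalk n x y)
    {C : ℕ → V} (hC : G.IsClosedSeq (2 * k + 1) C) {x : V} (hx : G.Adj x (C 0))
    (hne : x ≠ C 2) (hadj : ¬ G.Adj x (C 2)) :
    ∃ (m : ℕ) (v : V) (F : ℕ → V), 3 ≤ m ∧ m < 2 * k ∧ G.Sits (2 * k + 1) C v m ∧
      G.Sits (2 * k + 1) F v m ∧ G.IsClosedSeq (2 * k + 1) F ∧ F 0 = C 0 ∧ F (2 * k) = x := by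
  obtain ⟨n, hn, hn', w⟩ := hmax x (C 2) hne hadj
  have w2 := hC.hasWalk (i := 0) (j := 2) (by omega) (by omega)
  have h1 := hG.le_add w ((hx.hasWalk).trans w2) (by omega)
  -- The path `x, C 0, C 1, C 2` closes the even walk to odd length `n + 3`, so `n` attains its
  -- upper bound.
  obtain rfl : n = 2 * k - 2 := by omega
  obtain ⟨y, y0, y1, hy⟩ := w.exists_seq
  have hF : G.IsClosedSeq (2 * k + 1)
      fun i => if i < 2 then C i else if i ≤ 2 * k then y (2 * k - i) else C 0 := by
    constructor
    · rw [if_neg (by omega), if_neg (by omega), if_pos (by omega)]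
    · intro i hi
      rcases lt_trichotomy i 1 with h | h | h
      · rw [if_pos (by omega), if_pos (by omega)]
        exact hC.adj i hi
      · subst h
        rw [if_pos (by omega), if_neg (by omega), if_pos (by omega), y1]
        exact hC.adj 1 hi
      · rw [if_neg (by omega), if_pos (by omega), if_neg (by omega)]
        by_cases e : i = 2 * k
        · rw [if_neg (by omega), e, Nat.sub_self, y0]
          exact hx
        · rw [if_pos (by omega)]
          have := hy (2 * k - (i + 1)) (by omega)
          rw [show 2 * k - (i + 1) + 1 = 2 * k - i by omega] at this
          exact this.symm
  set F : ℕ → V := fun i => if i < 2 then C i else if i ≤ 2 * k then y (2 * k - i) else C 0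
    with hFdef
  have f0 : F 0 = C 0 := by simp [hFdef]
  have f2 : F 2 = C 2 := by
    simp only [hFdef]
    rw [if_neg (by omega), if_pos (by omega), y1]
  have fx : F (2 * k) = x := by
    simp only [hFdef]
    rw [if_neg (by omega), if_pos (by omega), Nat.sub_self, y0]
  clear_value F
  clear hFdef hy y0 y1 w2 h1
  -- Omitting positions `0` and `1` of `F` makes the total `4k` and forces `3 ≤ m < 2k`.
  obtain ⟨v, hv⟩ := exists_four_le_card hdeg (Finset.range (2 * k + 1))
    (Finset.Ico 2 (2 * k + 1)) ∅ ∅ C F C C (by omega) (by simp; omega)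
  have s1 : ∀ i ∈ Finset.range (2 * k + 1), i < 2 * k + 1 := by simp
  have s2 : ∀ i ∈ Finset.Ico 2 (2 * k + 1), i < 2 * k + 1 := by simp
  have c1 := hG.card_filter_le_two hk hC v s1
  have c2 := hG.card_filter_le_two hk hF v s2
  simp only [Finset.filter_empty, Finset.card_empty, add_zero] at hv
  obtain ⟨p, hp, -⟩ := hG.exists_sits_of_two_le_card hk hC (v := v) s1 (by omega)
  obtain ⟨m, hm, nm⟩ := hG.exists_sits_of_two_le_card hk hF (v := v) s2 (by omega)
  obtain ⟨i, j, hij, hi, hj, hvi, hvj⟩ := Tetra.exists_pair_of_two_le_card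
    (show 2 ≤ _ by omega : 2 ≤ ((Finset.Ico 2 (2 * k + 1)).filter fun i => G.Adj v (F i)).card)
  rw [Finset.mem_Ico] at hi hj
  have hi2 := nm i (by omega) hvi
  have hj2 := nm j (by omega) hvj
  have hpm := hG.sits_pair hk hC hF (ℓ := 2) (by omega) (by omega) f0.symm f2.symm hp hm
  obtain rfl : p = m := by omega
  exact ⟨p, v, F, by omega, by omega, hp, hm, hF, f0, fx⟩

/-- Detours to `x` in both directions along `C` produce vertices `v` and `w`. In the generic case,
if `m + n < 2k+1` they bound a tetrahedron with spoke `α = 1` from `C 0` to `x`; if equal, a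
diagonal across a shared edge; if larger, an odd closed walk of length `2k - 1`. -/
theorem exists_adj_of_adj_zero [Fintype V] [DecidableRel G.Adj] (hk : 2 ≤ k) (hG : G.OddFree k)
    (hdeg : ∀ v, 3 * Fintype.card V < 4 * k * G.degree v)
    (hmax : ∀ x y, x ≠ y → ¬ G.Adj x y → ∃ n, n % 2 = 0 ∧ n ≤ 2 * k - 2 ∧ G.HasWalk n x y)
    {C : ℕ → V} (hC : G.IsClosedSeq (2 * k + 1) C) {x : V} (hx : G.Adj x (C 0)) :
    ∃ i, 1 ≤ i ∧ i ≤ 2 * k ∧ G.Adj x (C i) := by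
  by_contra! hcon
  have hcl := hC.closed
  have x2 : x ≠ C 2 := by
    rintro rfl
    exact hcon 1 le_rfl (by omega) (hC.adj 1 (by omega)).symm
  have x2' : x ≠ C (2 * k - 1) := by
    rintro rfl
    have := hC.adj (2 * k - 1) (by omega)
    rw [show 2 * k - 1 + 1 = 2 * k by omega] at this
    exact hcon (2 * k) (by omega) le_rfl this
  obtain ⟨m, v, F, hm, hm', vC, vF, hF, f0, fx⟩ := exists_detour hk hG hdeg hmax hC hx x2
    (hcon 2 (by omega) (by omega))
  have vx := vF.walk_up hF hm' (by omega)
  rw [fx] at vx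
  have hF₁ := vC.isClosedSeq_splice hC hF f0.symm vF (by omega)
  -- Here `v` is adjacent to `x`, so it cannot replace `C (2k - 1)` before the second detour; the
  -- original `C` is used instead.
  by_cases hm2 : m = 2 * k - 1
  · obtain ⟨n, w, E, hn, hn', wC, wE, hE, e0, ex⟩ := exists_detour hk hG hdeg hmax hC.reverse
      (x := x) (by simpa [hcl] using hx)
      (by rwa [show 2 * k + 1 - 2 = 2 * k - 1 by omega]) (hcon _ (by omega) (by omega))
    by_cases h3 : n = 3
    · have hF₂ := wC.isClosedSeq_splice hC.reverse hE e0.symm wE (by omega)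
      refine hG.not_adj_of_shared_edge hk hdeg hF₁ hF₂ ?_ ?_ (m := 2 * k - 2) (by omega)
        (by omega) (Or.inr ⟨rfl, ?_⟩) ?_
      · rw [if_pos (by omega), if_pos (by omega)]
        exact hcl.symm
      · rw [if_neg (by omega), if_neg (by omega), if_neg (by omega), if_neg (by omega), fx, ex]
      · rw [if_neg (by omega), if_pos hm2.symm, if_pos (by omega)]
        have := vC.next
        rwa [hm2, show 2 * k - 1 + 1 = 2 * k + 1 - 1 by omega] at this
      · rw [if_pos (by omega), if_pos (by omega)]
        have := hC.adj (2 * k - 2) (by omega)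
        rwa [show 2 * k - 2 + 1 = 2 * k + 1 - (2 * k - (2 * k - 2)) by omega] at this
    · have wx := wE.walk_up hE hn' (by omega)
      have wC3 := wC.walk_down hC.reverse (i := 3) (by omega)
      have hv3 := (vC.prev (by omega)).symm.hasWalk
      rw [ex] at wx
      rw [show 2 * k + 1 - 3 = m - 1 by omega] at wC3
      have := hG.le_add (wC3.trans hv3) (wx.trans vx.symm)
      omega
  · have hC' := vC.isClosedSeq_update hC (by omega)
    have cL : (if 2 * k + 1 = m then v else C (2 * k + 1)) = C 0 := by
      rw [if_neg (by omega), hcl]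
    obtain ⟨n, w, E, hn, hn', wC, wE, hE, e0, ex⟩ := exists_detour hk hG hdeg hmax hC'.reverse
      (x := x) (by rwa [Nat.sub_zero, cL])
      (by rwa [if_neg (by omega), show 2 * k + 1 - 2 = 2 * k - 1 by omega])
      (by rw [if_neg (by omega)]; exact hcon _ (by omega) (by omega))
    have wx := wE.walk_up hE hn' (by omega)
    rw [ex] at wx
    have hF₂ := wC.isClosedSeq_splice hC'.reverse hE e0.symm wE (by omega)
    have e0' : E 0 = C 0 := by rw [e0, Nat.sub_zero, cL]
    rcases lt_trichotomy (m + n) (2 * k + 1) with h | h | h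
    · have hC'' := (wC.isClosedSeq_update hC'.reverse (by omega)).reverse
      refine hG.not_tetra hk hdeg ⟨hC'', hF₁, hF₂, ?_, ?_, ?_, le_rfl, hm, hn, ?_, ?_, h⟩
      · intro i hi
        by_cases e : i = m
        · rw [if_neg (by omega), if_pos e, if_neg (by omega), if_pos (by omega)]
        · rw [if_pos (by omega), if_neg (by omega), if_neg (by omega),
            show 2 * k + 1 - (2 * k + 1 - i) = i by omega]
      · intro i hi
        rw [show 2 * k + 1 - (2 * k + 1 - i) = i by omega]
        by_cases e : i = n
        · rw [if_neg (by omega), if_pos e, if_pos e]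
        · rw [if_pos (by omega), if_neg e]
      · intro i hi
        rw [if_neg (by omega), if_neg (by omega), if_neg (by omega), if_neg (by omega)]
        rcases (by omega : i = 0 ∨ i = 1) with rfl | rfl
        · rw [Nat.sub_zero, hF.closed, hE.closed, f0, e0']
        · rw [Nat.add_sub_cancel, fx, ex]
      · omega
      · omega
    · refine hG.not_adj_of_shared_edge hk hdeg hF₁ hF₂ ?_ ?_ (m := m) (by omega)
        (by omega) (Or.inl (by omega)) ?_
      · rw [if_pos (by omega), if_pos (by omega), Nat.sub_zero, cL]
      · rw [if_neg (by omega), if_neg (by omega), if_neg (by omega), if_neg (by omega), fx, ex]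
      · rw [if_neg (by omega), if_pos rfl, if_pos (by omega), if_neg (by omega),
          show 2 * k + 1 - (2 * k - m) = m + 1 by omega]
        exact vC.next
    · have wv := wC.walk_down hC'.reverse (i := 2 * k + 1 - m) (by omega)
      rw [if_pos (by omega)] at wv
      have := hG.le_add wv (wx.trans vx.symm)
      omega

theorem IsClosedSeq.rotate {L : ℕ} {C : ℕ → V} (hC : G.IsClosedSeq L C) {r : ℕ} (hr : r < L) :
    G.IsClosedSeq L fun i => if i + r < L then C (i + r) else C (i + r - L) where
  closed := by
    rw [if_neg (by omega), if_pos (by omega)]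
    congr 1
    omega
  adj i hi := by
    by_cases h : i + 1 + r < L
    · rw [if_pos (by omega), if_pos h, show i + 1 + r = i + r + 1 by omega]
      exact hC.adj _ (by omega)
    · rw [if_neg h]
      by_cases h' : i + r < L
      · rw [if_pos h', show i + 1 + r - L = 0 by omega, ← hC.closed]
        have := hC.adj (i + r) h'
        rwa [show i + r + 1 = L by omega] at this
      · rw [if_neg h', show i + 1 + r - L = i + r - L + 1 by omega]
        exact hC.adj _ (by omega)

theorem Sits.isClosedSeq_update_zero {L : ℕ} {F : ℕ → V} {v : V} (hF : G.IsClosedSeq L F)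
    (h : G.Sits L F v 0) : G.IsClosedSeq L fun i => if i = 0 ∨ i = L then v else F i where
  closed := by simp
  adj i hi := by
    have h1 := h.next
    have h2 := h.prev_zero rfl
    by_cases e : i = 0
    · subst e
      by_cases e' : L = 1
      · subst e'
        exact absurd (hF.closed ▸ hF.adj 0 hi) (G.loopless.irrefl _)
      · rw [if_pos (by omega), if_neg (by omega)]
        exact h1
    · rw [if_neg (by omega)]
      by_cases e' : i + 1 = L
      · rw [if_pos (by omega), show i = L - 1 by omega]
        exact h2.symm
      · rw [if_neg (by omega)]
        exact hF.adj i hi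

section
variable [Fintype V] [DecidableRel G.Adj] (hk : 2 ≤ k) (hG : G.OddFree k)
    (hdeg : ∀ v, 3 * Fintype.card V < 4 * k * G.degree v)
    (hmax : ∀ x y, x ≠ y → ¬ G.Adj x y → ∃ n, n % 2 = 0 ∧ n ≤ 2 * k - 2 ∧ G.HasWalk n x y)
    {C : ℕ → V} (hC : G.IsClosedSeq (2 * k + 1) C)
include hk hG hdeg hmax hC

theorem exists_second_adj {x : V} {r : ℕ} (hr : r < 2 * k + 1) (hx : G.Adj x (C r)) :
    ∃ s, s < 2 * k + 1 ∧ s ≠ r ∧ G.Adj x (C s) := by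
  obtain ⟨i, hi, hi', hxi⟩ := exists_adj_of_adj_zero hk hG hdeg hmax (hC.rotate hr) (x := x)
    (by rwa [if_pos (by omega), Nat.zero_add])
  split_ifs at hxi with h
  · exact ⟨_, h, by omega, hxi⟩
  · exact ⟨_, by omega, by omega, hxi⟩

/-- Reroute `C` through `u`: the second neighbour of `w` on the new walk is at an unchanged
position. -/
theorem exists_adj_of_adj {u w : V} (huw : G.Adj w u) (hu : ∃ r, r < 2 * k + 1 ∧ G.Adj u (C r)) :
    ∃ r, r < 2 * k + 1 ∧ G.Adj w (C r) := by
  obtain ⟨r, hr, hur⟩ := hu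
  obtain ⟨s, hs, hsr, hus⟩ := exists_second_adj hk hG hdeg hmax hC hr hur
  obtain ⟨m, hm, -⟩ := hG.sits_of_adj hk hC hsr hs hr hus hur
  rcases Nat.eq_zero_or_pos m with rfl | hm0
  · obtain ⟨t, ht, htm, hwt⟩ := exists_second_adj hk hG hdeg hmax (hm.isClosedSeq_update_zero hC)
      (x := w) (r := 0) (by omega) (by simpa using huw)
    rw [if_neg (by omega)] at hwt
    exact ⟨t, ht, hwt⟩
  · obtain ⟨t, ht, htm, hwt⟩ := exists_second_adj hk hG hdeg hmax (hm.isClosedSeq_update hC hm0)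
      (x := w) hm.lt (by simpa using huw)
    rw [if_neg htm] at hwt
    exact ⟨t, ht, hwt⟩

theorem exists_sits (v : V) : ∃ m, G.Sits (2 * k + 1) C v m := by
  have hw : ∃ n, G.HasWalk n v (C 0) := by
    by_cases e : v = C 0
    · exact ⟨0, e ▸ HasWalk.refl _⟩
    · by_cases h : G.Adj v (C 0)
      · exact ⟨1, h.hasWalk⟩
      · obtain ⟨n, -, -, hn⟩ := hmax v (C 0) e h
        exact ⟨n, hn⟩
  obtain ⟨n, p, -⟩ := hw
  have : ∃ r, r < 2 * k + 1 ∧ G.Adj v (C r) := by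
    clear n
    generalize hz : C 0 = z at p
    induction p with
    | nil => exact ⟨1, by omega, hz ▸ hC.adj 0 (by omega)⟩
    | cons h _ ih => exact exists_adj_of_adj hk hG hdeg hmax hC h (ih hz)
  obtain ⟨r, hr, hvr⟩ := this
  obtain ⟨s, hs, hsr, hvs⟩ := exists_second_adj hk hG hdeg hmax hC hr hvr
  obtain ⟨m, hm, -⟩ := hG.sits_of_adj hk hC hsr hs hr hvs hvr
  exact ⟨m, hm⟩

end

/-! ### Homomorphism to the odd cycle, and averaging -/

theorem Sits.consecutive_of_adj (hk : 2 ≤ k) (hG : G.OddFree k) {C : ℕ → V}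
    (hC : G.IsClosedSeq (2 * k + 1) C) {u v : V} {i j : ℕ} (hu : G.Sits (2 * k + 1) C u i)
    (hv : G.Sits (2 * k + 1) C v j) (huv : G.Adj u v) :
    j = i + 1 ∨ i = j + 1 ∨ (i = 0 ∧ j = 2 * k) ∨ (j = 0 ∧ i = 2 * k) := by
  wlog h : i ≤ j generalizing u v i j
  · have := this hv hu huv.symm (by omega)
    omega
  have hi := hu.lt
  have hj := hv.lt
  rcases h.eq_or_lt with rfl | h
  · have := hG.le_add (hu.next.hasWalk.trans hv.next.symm.hasWalk) huv.hasWalk (by norm_num)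
    omega
  · by_contra hcon
    have w1 := hu.walk_up hC (i := j - 1) (by omega) (by omega)
    have h1 := hG.le_add (w1.trans (hv.prev (by omega)).symm.hasWalk) huv.hasWalk
    have h2 : G.HasWalk (2 * k + 1 - j + i) u v := by
      by_cases e : j = 2 * k
      · have := hv.next
        rw [e, hC.closed] at this
        exact ((hu.walk_down hC (i := 0) (by omega)).trans this.symm.hasWalk).congr (by omega)
      · exact ((hu.walk_down_around hC (i := j + 1) (by omega) (by omega)).trans
          hv.next.symm.hasWalk).congr (by omega)
    have h3 := hG.le_add h2 huv.hasWalk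
    omega

/-- A graph all of whose vertices sit on a fixed cycle of length `2 * k + 1` has a large
independent set. -/
theorem exists_isIndepSet_of_sits [Fintype V] (hk : 2 ≤ k) (hG : G.OddFree k) {C : ℕ → V}
    (hC : G.IsClosedSeq (2 * k + 1) C) (hs : ∀ v, ∃ m, G.Sits (2 * k + 1) C v m) :
    ∃ s : Finset V, G.IsIndepSet (s : Set V) ∧ k * Fintype.card V ≤ (2 * k + 1) * s.card := by
  classical
  choose p hp using hs
  have inj : ∀ a b : ℕ, a < 2 * k + 1 → b < 2 * k + 1 →
      (a : ZMod (2 * k + 1)) = (b : ZMod (2 * k + 1)) → a = b := by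
    intro a b ha hb h
    rwa [ZMod.natCast_eq_natCast_iff', Nat.mod_eq_of_lt ha, Nat.mod_eq_of_lt hb] at h
  have hstep : ∀ u v, G.Adj u v → (p v : ZMod (2 * k + 1)) = p u + 1 ∨
      (p u : ZMod (2 * k + 1)) = p v + 1 := by
    intro u v huv
    have hz : ((2 * k : ℕ) : ZMod (2 * k + 1)) + 1 = 0 := by
      have := ZMod.natCast_self (2 * k + 1)
      rwa [Nat.cast_succ] at this
    rcases (hp u).consecutive_of_adj hk hG hC (hp v) huv with h | h | ⟨h, h'⟩ | ⟨h, h'⟩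
    · left
      rw [h]
      push_cast
      rfl
    · right
      rw [h]
      push_cast
      rfl
    · right
      rw [h, h', hz, Nat.cast_zero]
    · left
      rw [h, h', hz, Nat.cast_zero]
  -- Preimages of the translates of `{0, 2, …, 2(k-1)}`, which is independent in the cycle; each
  -- vertex lies in exactly `k` of them.
  let I : ZMod (2 * k + 1) → Finset V := fun r =>
    Finset.univ.filter fun v => ∃ s ∈ Finset.range k,
      (p v : ZMod (2 * k + 1)) - ((2 * s : ℕ) : ZMod (2 * k + 1)) = r
  have hI : ∀ r, G.IsIndepSet (I r : Set V) := by
    intro r u hu v hv _ huv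
    simp only [I, Finset.coe_filter, Finset.mem_univ, true_and, Set.mem_ofPred_eq,
      Finset.mem_range] at hu hv
    obtain ⟨s, hs, hs'⟩ := hu
    obtain ⟨t, ht, ht'⟩ := hv
    rcases hstep u v huv with h | h
    · have := inj (2 * t) (2 * s + 1) (by omega) (by omega) (by
        rw [Nat.cast_succ]
        linear_combination hs' - ht' + h)
      omega
    · have := inj (2 * s) (2 * t + 1) (by omega) (by omega) (by
        rw [Nat.cast_succ]
        linear_combination ht' - hs' + h)
      omega
  have hsum : ∑ r, (I r).card = k * Fintype.card V := by
    have hv : ∀ v, (Finset.univ.filter fun r => v ∈ I r).card = k := by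
      intro v
      refine Eq.trans (Eq.symm ?_) (Finset.card_range k)
      refine Finset.card_bij (fun s _ => (p v : ZMod (2 * k + 1)) - ((2 * s : ℕ) : ZMod (2 * k + 1)))
        ?_ ?_ ?_
      · intro s hs
        simpa [I] using ⟨s, Finset.mem_range.mp hs, rfl⟩
      · intro s hs t ht h
        rw [Finset.mem_range] at hs ht
        have := inj (2 * s) (2 * t) (by omega) (by omega) (sub_right_injective h)
        omega
      · intro r hr
        simp only [I, Finset.mem_filter, Finset.mem_univ, true_and] at hr
        obtain ⟨s, hs, hs'⟩ := hr
        exact ⟨s, hs, hs'⟩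
    have := Finset.sum_card_bipartiteAbove_eq_sum_card_bipartiteBelow
      (s := (Finset.univ : Finset (ZMod (2 * k + 1)))) (t := (Finset.univ : Finset V))
      (fun r v => v ∈ I r)
    simp only [Finset.bipartiteAbove, Finset.bipartiteBelow, hv, Finset.sum_const,
      Finset.card_univ, smul_eq_mul, Finset.filter_univ_mem] at this
    rw [this, mul_comm]
  by_contra! hcon
  have := Finset.sum_lt_sum_of_nonempty (s := (Finset.univ : Finset (ZMod (2 * k + 1))))
    Finset.univ_nonempty fun r _ => hcon (I r) (hI r)
  rw [← Finset.mul_sum, hsum, Finset.sum_const, Finset.card_univ, ZMod.card, smul_eq_mul] at this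
  exact lt_irrefl _ this

/-! ### Shortest odd closed walks and edge-maximal graphs -/

theorem injective_of_minimal {n : ℕ} {F : ℕ → V} (hF : G.IsClosedSeq n F) (hn : n % 2 = 1)
    (hmin : G.OddFree (n / 2)) {i j : ℕ} (hij : i < j) (hj : j < n) : F i ≠ F j := by
  intro h
  have h1 := hF.hasWalk hij.le hj.le
  have h2 := hF.hasWalk hj.le le_rfl
  have h3 := hF.hasWalk (Nat.zero_le i) (by omega)
  rw [← h] at h1 h2
  rw [hF.closed] at h2
  -- A repeated vertex splits the walk into two shorter closed walks, one of them odd.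
  have h4 := hmin _ _ h1
  have h5 := hmin _ _ (h2.trans h3)
  omega

/-- Either there are no odd closed walks, or there is a shortest one. -/
theorem exists_oddFree (G : SimpleGraph V) :
    (∀ n u, G.HasWalk n u u → n % 2 = 0) ∨
      ∃ l, G.OddFree l ∧ ∃ F, G.IsClosedSeq (2 * l + 1) F := by
  classical
  by_cases h : ∃ n, n % 2 = 1 ∧ ∃ u, G.HasWalk n u u
  · right
    obtain ⟨h1, u, h2⟩ := Nat.find_spec h
    have hm := fun m => Nat.find_min' h (m := m)
    generalize Nat.find h = n at h1 h2 hm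
    refine ⟨n / 2, fun m v hv hodd => ?_, ?_⟩
    · have := hm m ⟨hodd, v, hv⟩
      omega
    · obtain ⟨F, f0, fn, hF⟩ := h2.exists_seq
      rw [show 2 * (n / 2) + 1 = n by omega]
      exact ⟨F, by rw [f0, fn], hF⟩
  · left
    intro n u hu
    by_contra hn
    exact h ⟨n, by omega, u, hu⟩

theorem le_of_oddGirthAtLeast {l : ℕ} (h : OddGirthAtLeast G (2 * k + 1)) (hl : G.OddFree l)
    {F : ℕ → V} (hF : G.IsClosedSeq (2 * l + 1) F) : k ≤ l := by
  have hl0 : l ≠ 0 := by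
    rintro rfl
    exact absurd (hF.closed ▸ hF.adj 0 (by omega)) (G.loopless.irrefl _)
  have hw := hF.hasWalk (Nat.zero_le _) le_rfl
  rw [hF.closed] at hw
  generalize F 0 = u at hw
  clear hF
  obtain ⟨p, hp⟩ := hw
  suffices hc : p.IsCycle by
    have := h u p hc (by rw [hp]; exact ⟨l, by omega⟩)
    omega
  have hseq : G.IsClosedSeq (2 * l + 1) p.getVert :=
    ⟨by rw [p.getVert_zero, p.getVert_of_length_le (by omega)],
      fun i hi => p.adj_getVert_succ (by omega)⟩
  have hinj : ∀ i j, i < j → j < 2 * l + 1 → p.getVert i ≠ p.getVert j := fun i j hij hj =>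
    injective_of_minimal hseq (by omega) (by rwa [show (2 * l + 1) / 2 = l by omega]) hij hj
  cases p with
  | nil => simp at hp
  | cons e q =>
    rw [Walk.length_cons] at hp
    have hq : q.IsPath := by
      rw [← Walk.IsPath.getVert_injOn_iff]
      have key : ∀ i j, i < j → j ≤ q.length → q.getVert i ≠ q.getVert j := by
        intro i j hij hj
        by_cases hj' : j = q.length
        · subst hj'
          have := hinj 0 (i + 1) (by omega) (by omega)
          rw [Walk.getVert_zero, Walk.getVert_cons_succ] at this
          rw [Walk.getVert_length]
          exact this.symm
        · have := hinj (i + 1) (j + 1) (by omega) (by omega)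
          rwa [Walk.getVert_cons_succ, Walk.getVert_cons_succ] at this
      intro i hi j hj hij
      rcases lt_trichotomy i j with h | h | h
      · exact absurd hij (key i j h hj)
      · exact h
      · exact absurd hij.symm (key j i h hi)
    rw [Walk.cons_isCycle_iff]
    refine ⟨hq, fun hmem => ?_⟩
    rw [Sym2.eq_swap] at hmem
    have := hq.length_eq_one_of_mem_edges hmem
    omega

/-- Adding `xy` to a maximal graph creates an odd closed walk that is too short. A shortest one
repeats no vertex, so it uses `xy` exactly once, and the rest is the even walk. -/
theorem OddFree.exists_maximal [Finite V] (hG : G.OddFree k) :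
    ∃ H, G ≤ H ∧ H.OddFree k ∧ ∀ x y, x ≠ y → ¬ H.Adj x y →
      ∃ n, n % 2 = 0 ∧ n ≤ 2 * k - 2 ∧ H.HasWalk n x y := by
  obtain ⟨H, hGH, hH⟩ := Finite.exists_le_maximal (p := fun H : SimpleGraph V => H.OddFree k) hG
  refine ⟨H, hGH, hH.prop, fun x y hxy hadj => ?_⟩
  have hlt : ¬ (H ⊔ edge x y).OddFree k := fun h =>
    hadj ((hH.le_of_ge h le_sup_left) (Or.inr (by simp [edge_adj, hxy])))
  rcases exists_oddFree (H ⊔ edge x y) with h | ⟨l, hl, F, hF⟩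
  · exact absurd (fun n u hu hn => by have := h n u hu; omega) hlt
  have hlk : l < k := by
    by_contra! hkl
    exact hlt fun n u hu hn => by have := hl n u hu hn; omega
  have hl0 : l ≠ 0 := by
    rintro rfl
    exact absurd (hF.closed ▸ hF.adj 0 (by omega)) ((H ⊔ edge x y).loopless.irrefl _)
  have hinj : ∀ i j, i < 2 * l + 1 → j < 2 * l + 1 → F i = F j → i = j := by
    have key : ∀ i j, i < j → j < 2 * l + 1 → F i ≠ F j := fun i j hij hj =>
      injective_of_minimal hF (by omega) (by rwa [show (2 * l + 1) / 2 = l by omega]) hij hj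
    intro i j hi hj h
    rcases lt_trichotomy i j with h' | h' | h'
    · exact absurd h (key i j h' hj)
    · exact h'
    · exact absurd h.symm (key j i h' hi)
  have hedge : ∀ i, i < 2 * l + 1 → H.Adj (F i) (F (i + 1)) ∨
      (F i = x ∧ F (i + 1) = y ∨ F i = y ∧ F (i + 1) = x) := by
    intro i hi
    have := hF.adj i hi
    rw [sup_adj, edge_adj] at this
    tauto
  by_cases hall : ∀ i, i < 2 * l + 1 → H.Adj (F i) (F (i + 1))
  · have w := hasWalk_of_seq (G := H) (Nat.zero_le (2 * l + 1)) fun t _ ht => hall t ht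
    rw [hF.closed] at w
    have := hH.prop _ _ w (by omega)
    omega
  push Not at hall
  obtain ⟨i, hi, hni⟩ := hall
  have hi' := (hedge i hi).resolve_left hni
  have hsucc : ∀ j, j < 2 * l + 1 → ∃ j', j' < 2 * l + 1 ∧ F (j + 1) = F j' ∧
      (j' = j + 1 ∨ (j = 2 * l ∧ j' = 0)) := by
    intro j hj
    by_cases e : j = 2 * l
    · exact ⟨0, by omega, by rw [e, hF.closed], by omega⟩
    · exact ⟨j + 1, by omega, rfl, by omega⟩
  have hother : ∀ j, j < 2 * l + 1 → j ≠ i → H.Adj (F j) (F (j + 1)) := by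
    intro j hj hji
    refine (hedge j hj).resolve_right fun hj' => ?_
    obtain ⟨i', a1, a2, a3⟩ := hsucc i hi
    obtain ⟨j', b1, b2, b3⟩ := hsucc j hj
    rw [a2] at hi'
    rw [b2] at hj'
    rcases hi' with ⟨c1, c2⟩ | ⟨c1, c2⟩ <;> rcases hj' with ⟨d1, d2⟩ | ⟨d1, d2⟩
    · exact hji (hinj j i hj hi (d1.trans c1.symm))
    · have := hinj j i' hj a1 (d1.trans c2.symm)
      have := hinj j' i b1 hi (d2.trans c1.symm)
      omega
    · have := hinj j i' hj a1 (d1.trans c2.symm)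
      have := hinj j' i b1 hi (d2.trans c1.symm)
      omega
    · exact hji (hinj j i hj hi (d1.trans c1.symm))
  have w1 : H.HasWalk _ (F (i + 1)) (F (2 * l + 1)) :=
    hasWalk_of_seq (by omega) fun t h1 h2 => hother t h2 (by omega)
  have w2 : H.HasWalk _ (F 0) (F i) :=
    hasWalk_of_seq (Nat.zero_le i) fun t h1 h2 => hother t (by omega) (by omega)
  rw [hF.closed] at w1
  have w := w1.trans w2
  rcases hi' with ⟨c1, c2⟩ | ⟨c1, c2⟩ <;> rw [c1, c2] at w
  · exact ⟨_, by omega, by omega, w.symm⟩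
  · exact ⟨_, by omega, by omega, w⟩

theorem exists_isIndepSet_of_colorable_two [Fintype V] (h : G.Colorable 2) :
    ∃ s : Finset V, G.IsIndepSet (s : Set V) ∧ Fintype.card V ≤ 2 * s.card := by
  classical
  obtain ⟨c⟩ := h
  have hI : ∀ a, G.IsIndepSet ((Finset.univ.filter fun v => c v = a : Finset V) : Set V) := by
    intro a u hu v hv _ huv
    simp only [Finset.coe_filter, Finset.mem_univ, true_and, Set.mem_ofPred_eq] at hu hv
    exact c.valid huv (hu.trans hv.symm)
  by_contra! hcon
  have h0 := hcon _ (hI 0)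
  have h1 := hcon _ (hI 1)
  have := Finset.card_eq_sum_card_fiberwise (s := (Finset.univ : Finset V))
    (t := (Finset.univ : Finset (Fin 2))) (f := c) (fun _ _ => by simp)
  rw [Fin.sum_univ_two, Finset.card_univ] at this
  omega

end SimpleGraph

/-! ### Passing from `k` to the actual odd girth -/

open SimpleGraph in
theorem mainTheorem5 {V : Type*} [Fintype V] (G : SimpleGraph V) [DecidableRel G.Adj]
    (k : ℕ) (hk : 2 ≤ k)
    (hgirth : OddGirthAtLeast G (2 * k + 1))
    (hdeg : (G.minDegree : ℝ) > 3 * (Fintype.card V : ℝ) / (4 * (k : ℝ))) :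
    ∃ s : Finset V, G.IsIndepSet (s : Set V) ∧
      (s.card : ℝ) ≥ (k : ℝ) * (Fintype.card V : ℝ) / (2 * (k : ℝ) + 1) := by
  classical
  suffices h : ∃ s : Finset V, G.IsIndepSet (s : Set V) ∧
      k * Fintype.card V ≤ (2 * k + 1) * s.card by
    obtain ⟨s, hs, hc⟩ := h
    refine ⟨s, hs, ?_⟩
    rw [ge_iff_le, div_le_iff₀ (by positivity), mul_comm (s.card : ℝ)]
    exact_mod_cast hc
  rcases exists_oddFree G with h | ⟨l, hl, F, hF⟩
  · obtain ⟨s, hs, hc⟩ := exists_isIndepSet_of_colorable_two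
      (two_colorable_iff_forall_loop_even.mpr fun u w => Nat.even_iff.mpr (h _ u ⟨w, rfl⟩))
    exact ⟨s, hs, by nlinarith⟩
  · have hkl := le_of_oddGirthAtLeast hgirth hl hF
    obtain ⟨H, hGH, hH, hmax⟩ := hl.exists_maximal
    have hFH : H.IsClosedSeq (2 * l + 1) F := ⟨hF.closed, fun i hi => hGH (hF.adj i hi)⟩
    have hdegH : ∀ v, 3 * Fintype.card V < 4 * l * H.degree v := by
      intro v
      have h1 : 3 * Fintype.card V < 4 * k * G.minDegree := by
        rw [gt_iff_lt, div_lt_iff₀ (by positivity), mul_comm (G.minDegree : ℝ)] at hdeg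
        exact_mod_cast hdeg
      have h2 : G.minDegree ≤ H.degree v := (G.minDegree_le_degree v).trans (degree_le_of_le hGH)
      exact h1.trans_le (Nat.mul_le_mul (by omega) h2)
    obtain ⟨s, hs, hc⟩ := exists_isIndepSet_of_sits (by omega) hH hFH
      (exists_sits (by omega) hH hdegH hmax hFH)
    refine ⟨s, fun u hu v hv huv hadj => hs hu hv huv (hGH hadj), ?_⟩
    have h1 : k * (l * Fintype.card V) ≤ k * ((2 * l + 1) * s.card) := Nat.mul_le_mul_left k hc
    -- The ratio `k / (2k+1)` is monotone in `k`.
    have h2 : k * (2 * l + 1) ≤ l * (2 * k + 1) := by nlinarith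
    have h3 := Nat.mul_le_mul_right s.card h2
    have h4 : l * (k * Fintype.card V) ≤ l * ((2 * k + 1) * s.card) := by nlinarith
    exact Nat.le_of_mul_le_mul_left h4 (by omega)
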